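/- **Definitions.** A *causal influence diagram* (CID) is a finite directed acyclic graph $\mathcal G$ whose vertex set $V$ is partitioned into structure nodes, decision nodes and utility nodes, where utility nodes have no children. It is *single-decision* if it has exactly one decision node $D$. Write $\mathrm{Pa}_v$ for the set of parents of $v$ and $\mathrm{Fa}_v=\{v\}\cup \mathrm{Pa}_v$; directed paths may have length zero. A *structural causal influence model* (SCIM) compatible with $\mathcal G$ consists of: a finite nonempty domain $\mathrm{dom}(v)$ for every node $v$, with $\mathrm{dom}(U)\subset\mathbb R$ for each utility node $U$; a finite-domain exogenous variable $\mathcal E^v$ for every node $v$; a structural function $f_v:\mathrm{dom}(\mathrm{Pa}_v)\times\mathrm{dom}(\mathcal E^v)\to\mathrm{dom}(v)$ for every structure or utility node $v$; and a probability distribution $P$ of $(\mathcal E^v)_{v\in V}$ under which the $\mathcal E^v$ are mutually independent. A *policy* is a function $\pi:\mathrm{dom}(\mathrm{Pa}_D)\times\mathrm{dom}(\mathcal E^D)\to\mathrm{dom}(D)$. With $\pi$ as structural function of $D$, each setting $\varepsilon$ of the exogenous variables determines a value $v(\varepsilon)$ of every node $v$ by recursion along the graph. The policy $\pi$ is *optimal*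 if it maximizes the expectation, over $\varepsilon\sim P$, of the sum of all utility nodes. For $x\in\mathrm{dom}(X)$, $D_x(\varepsilon)$ denotes the value of $D$ after the structural function of $X$ has been replaced by the constant $x$. A SCIM has a *response incentive* on a node $X\neq D$ if for every optimal policy there are $x\in\mathrm{dom}(X)$ and a setting $\varepsilon$ of the exogenous variables with $D_x(\varepsilon)\ne D(\varepsilon)$. The CID $\mathcal G$ is *compatible with* a response incentive on $X$ if some SCIM compatible with $\mathcal G$ has one. An undirected path (without repeated nodes) is *blocked* by a set $Z$ of nodes if it contains a chain $a\to b\to c$ (traversed in either direction) or a fork $a\leftarrow b\to c$ with $b\in Z$, or a collider $a\to b\leftarrow c$ such that neither $b$ nor any descendant of $b$ is in $Z$. Two nodes are *d-connected given $Z$* if some undirected path between them is not blocked by $Z$. **Theorem (Response Incentive Graphical Criterion).** Let $\mathcal G$ be a single-decision causal influence diagram with decision node $D$, and let $X\ne D$ be a node. Then $\mathcal G$ is compatible with a response incentive on $X$ if and only if there are a parent $W\in\mathrm{Pa}_D$ and a utility node $U$ such that 1. there is a directed path from $X$ to $W$, 2. there is a directed path from $D$ to $U$, and 3. $W$ is d-connected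 to $U$ given $\mathrm{Fa}_D\setminus\{W\}$. -/

import Mathlib

/-- A directed acyclic graph on the vertex set `V`; `G.Adj v w` is the edge `v → w`. -/
structure DAG (V : Type*) where
  /-- The edge relation. -/
  Adj : V → V → Prop
  acyclic : ∀ v, ¬ Relation.TransGen Adj v v

namespace DAG

variable {V : Type*} (G : DAG V)

/-- The parents of a node. -/
def parents (v : V) : Set V := {w | G.Adj w v}

/-- The family of a node: the node together with its parents. -/
def family (v : V) : Set V := insert v (G.parents v)

/-- There is a directed path, of length at least zero, from `v` to `w`. -/
def HasDirectedPath (v w : V) : Prop := Relation.ReflTransGen G.Adj v w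

/-- `w` is a proper descendant of `v`: there is a directed path of positive length. -/
def IsDescendant (v w : V) : Prop := Relation.TransGen G.Adj v w

/-- The underlying undirected graph. -/
def skeleton : SimpleGraph V := SimpleGraph.fromRel G.Adj

/-- The walk `p` is blocked (d-separated) by `Z`: it contains three consecutive nodes `a, b, c`
which form a chain (in either direction) or a fork with `b ∈ Z`, or which form a collider
such that neither `b` nor any descendant of `b` is in `Z`. -/
def Blocked (Z : Set V) {x y : V} (p : G.skeleton.Walk x y) : Prop :=
  ∃ i : ℕ, i + 2 ≤ p.length ∧ ∃ a b c : V,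
    a = p.getVert i ∧ b = p.getVert (i + 1) ∧ c = p.getVert (i + 2) ∧
    ((((G.Adj a b ∧ G.Adj b c) ∨ (G.Adj c b ∧ G.Adj b a) ∨ (G.Adj b a ∧ G.Adj b c)) ∧ b ∈ Z) ∨
      ((G.Adj a b ∧ G.Adj c b) ∧ b ∉ Z ∧ ∀ d, G.IsDescendant b d → d ∉ Z))

/-- `Z` d-separates `A` from `B`: it blocks every undirected path (that is, every walk without
repeated nodes) from a node of `A` to a node of `B`. -/
def DSep (A B Z : Set V) : Prop :=
  ∀ x ∈ A, ∀ y ∈ B, ∀ p : G.skeleton.Walk x y, p.IsPath → G.Blocked Z p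

/-- Sets that are not d-separated are d-connected. -/
def DConn (A B Z : Set V) : Prop := ¬ G.DSep A B Z

theorem wellFounded_adj [Finite V] : WellFounded G.Adj := by
  have : IsTrans V (Relation.TransGen G.Adj) := ⟨fun _ _ _ h h' => h.trans h'⟩
  have : Std.Irrefl (Relation.TransGen G.Adj) := ⟨G.acyclic⟩
  exact Subrelation.wf (fun h => Relation.TransGen.single h)
    (Finite.wellFounded_of_trans_of_irrefl (Relation.TransGen G.Adj))

end DAG

/-- A probability distribution on a product of exogenous variables makes the coordinates mutually
independent: the joint probability mass function is the product of its marginals. -/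
def MutuallyIndependent {V : Type*} [Fintype V] {Exo : V → Type} (P : PMF (∀ v, Exo v)) : Prop :=
  ∀ e : ∀ v, Exo v, P e = ∏ v, (P.map (fun e' => e' v)) (e v)

/-- A structural causal model (with independent errors) on the directed acyclic graph `G`. -/
structure SCM {V : Type*} [Fintype V] (G : DAG V) where
  /-- The domains of the structural variables. -/
  Dom : V → Type
  [finite_dom : ∀ v, Finite (Dom v)]
  [nonempty_dom : ∀ v, Nonempty (Dom v)]
  /-- The domains of the exogenous variables, one for each node. -/
  Exo : V → Type
  [fintype_exo : ∀ v, Fintype (Exo v)]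
  /-- The structural functions. -/
  f : ∀ v, (∀ w : G.parents v, Dom w) → Exo v → Dom v
  /-- The joint distribution of the exogenous variables. -/
  P : PMF (∀ v, Exo v)
  indep : MutuallyIndependent P

namespace SCM

variable {V : Type*} [Fintype V] {G : DAG V}

/-- The values of all variables at the setting `e` of the exogenous variables, by recursive
application of the structural functions. -/
noncomputable def eval (M : SCM G) (e : ∀ v, M.Exo v) : ∀ v, M.Dom v :=
  G.wellFounded_adj.fix (C := M.Dom) fun v ih => M.f v (fun w => ih w.1 w.2) (e v)

theorem eval_eq (M : SCM G) (e : ∀ v, M.Exo v) (v : V) :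
    M.eval e v = M.f v (fun w => M.eval e w.1) (e v) :=
  G.wellFounded_adj.fix_eq _ v

/-- The submodel given by the intervention `Do(X = x)`: the structural function of `X` is replaced
by the constant function with value `x`. -/
@[reducible] def intervene [DecidableEq V] (M : SCM G) (X : V) (x : M.Dom X) : SCM G :=
  { M with f := Function.update M.f X (fun _ _ => x) }

theorem intervene_f_self [DecidableEq V] (M : SCM G) (X : V) (x : M.Dom X) :
    (M.intervene X x).f X = fun _ _ => x :=
  Function.update_self X (fun _ _ => x) M.f

theorem intervene_f_of_ne [DecidableEq V] (M : SCM G) (X : V) (x : M.Dom X) (v : V) (h : v ≠ X) :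
    (M.intervene X x).f v = M.f v :=
  Function.update_of_ne h (fun _ _ => x) M.f

/-- The potential response `Y_x(e)`: the value of `Y` in the submodel for `Do(X = x)`. -/
noncomputable def potentialResponse [DecidableEq V] (M : SCM G) (X : V) (x : M.Dom X)
    (e : ∀ v, M.Exo v) (Y : V) : M.Dom Y :=
  (M.intervene X x).eval e Y

end SCM

/-- The three types of nodes of a causal influence diagram. -/
inductive NodeKind where
  /-- A structure node. -/
  | chance
  /-- A decision node. -/
  | decision
  /-- A utility node. -/
  | utility
  deriving DecidableEq

/-- A causal influence diagram: a directed acyclic graph whose vertex set is partitioned into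
structure, decision and utility nodes, such that utility nodes have no children. -/
structure CID (V : Type*) extends DAG V where
  /-- The partition of the nodes. -/
  kind : V → NodeKind
  utility_no_children : ∀ u v, kind u = NodeKind.utility → ¬ Adj u v

/-- `D` is the one and only decision node. -/
def CID.IsSingleDecision {V : Type*} (C : CID V) (D : V) : Prop :=
  ∀ v, C.kind v = NodeKind.decision ↔ v = D

/-- A structural causal influence model compatible with the causal influence diagram `C`. Decision
nodes have no structural function, but they do have an exogenous variable. -/
structure SCIM {V : Type*} [Fintype V] (C : CID V) where
  /-- The domains of the variables. -/
  Dom : V → Type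
  [finite_dom : ∀ v, Finite (Dom v)]
  [nonempty_dom : ∀ v, Nonempty (Dom v)]
  /-- The domains of utility variables are subsets of the real line. -/
  util : ∀ u, C.kind u = NodeKind.utility → (Dom u ↪ ℝ)
  /-- The domains of the exogenous variables, one for each node. -/
  Exo : V → Type
  [fintype_exo : ∀ v, Fintype (Exo v)]
  /-- The structural functions of the structure nodes and of the utility nodes. -/
  f : ∀ v, C.kind v ≠ NodeKind.decision → (∀ w : C.parents v, Dom w) → Exo v → Dom v
  /-- The joint distribution of the exogenous variables. -/
  P : PMF (∀ v, Exo v)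
  indep : MutuallyIndependent P

attribute [instance] SCIM.fintype_exo SCIM.finite_dom SCIM.nonempty_dom

namespace SCIM

variable {V : Type*} [Fintype V] {C : CID V}

/-- A policy for the decision `D`: a function of the parents and of the exogenous variable
of `D`. -/
def Policy (M : SCIM C) (D : V) : Type _ := (∀ w : C.parents D, M.Dom w) → M.Exo D → M.Dom D

/-- The structural causal model obtained from a single-decision model by using the policy as the
structural function of the decision. -/
@[reducible] noncomputable def withPolicy (M : SCIM C) {D : V} (hD : C.IsSingleDecision D) (π : M.Policy D) :
    SCM C.toDAG where
  Dom := M.Dom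
  finite_dom := M.finite_dom
  nonempty_dom := M.nonempty_dom
  Exo := M.Exo
  fintype_exo := M.fintype_exo
  f v := if h : C.kind v = NodeKind.decision then
      Eq.rec (motive := fun v _ => (∀ w : C.parents v, M.Dom w) → M.Exo v → M.Dom v)
        π ((hD v).1 h).symm
    else M.f v h
  P := M.P
  indep := M.indep

theorem withPolicy_f_decision (M : SCIM C) {D : V} (hD : C.IsSingleDecision D) (π : M.Policy D) :
    (M.withPolicy hD π).f D = π := by
  have h : C.kind D = NodeKind.decision := (hD D).2 rfl
  exact dif_pos h

theorem withPolicy_f_of_ne (M : SCIM C) {D : V} (hD : C.IsSingleDecision D) (π : M.Policy D)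
    (v : V) (h : C.kind v ≠ NodeKind.decision) : (M.withPolicy hD π).f v = M.f v h := by
  exact dif_neg h

/-- The sum of the utility variables, at the setting `e` of the exogenous variables, under the
policy `π`. -/
noncomputable def totalUtility (M : SCIM C) {D : V} (hD : C.IsSingleDecision D) (π : M.Policy D)
    (e : ∀ v, M.Exo v) : ℝ :=
  ∑ u : {u : V // C.kind u = NodeKind.utility}, M.util u.1 u.2 ((M.withPolicy hD π).eval e u.1)

/-- The expected total utility of the policy `π`. -/
noncomputable def expectedUtility [DecidableEq V] (M : SCIM C) {D : V} (hD : C.IsSingleDecision D)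
    (π : M.Policy D) : ℝ :=
  ∑ e : ∀ v, M.Exo v, (M.P e).toReal * M.totalUtility hD π e

/-- A policy is optimal if it maximizes the expected total utility. -/
def IsOptimal [DecidableEq V] (M : SCIM C) {D : V} (hD : C.IsSingleDecision D) (π : M.Policy D) : Prop :=
  ∀ π' : M.Policy D, M.expectedUtility hD π' ≤ M.expectedUtility hD π

/-- There is a response incentive on `X`: for every optimal policy there are an intervention
`Do(X = x)` and a setting `e` of the exogenous variables with `D_x(e) ≠ D(e)`. -/
def HasResponseIncentive [DecidableEq V] (M : SCIM C) {D : V} (hD : C.IsSingleDecision D) (X : V) : Prop :=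
  ∀ π : M.Policy D, M.IsOptimal hD π →
    ∃ (x : M.Dom X) (e : ∀ v, M.Exo v),
      (M.withPolicy hD π).potentialResponse X x e D ≠ (M.withPolicy hD π).eval e D

end SCIM

/-- The diagram is compatible with a response incentive on `X`: some compatible model has one. -/
def CID.CompatibleWithResponseIncentive {V : Type*} [Fintype V] [DecidableEq V] (C : CID V) {D : V}
    (hD : C.IsSingleDecision D) (X : V) : Prop :=
  ∃ M : SCIM C, M.HasResponseIncentive hD X

/-!
Necessity: deleting the part of an active walk between two visits of a node leaves it active, so
walks may replace paths. Let `N` be the set of all parents of `D` that are d-separated from every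
utility node `u` below `D`, let `Z` consist of the family of `D` without `N`, and let `R` be the
set of all ancestors of `u` and `Z`. The set `B` of all nodes with an active walk to `u` is
disjoint from the family of `D`, and it is closed under adjacency in the moral graph of `R`
without `Z`. Hence, if two settings agree on `Z`, they can exchange the exogenous variables of `B`
and its children: this exchanges the values of `u` but not those of `N`. As the exogenous variables
are independent, `u` as a function of the decision is independent of `N` given `Z`, and some
optimal policy ignores `N`. If the criterion fails, then `X` influences no other parent.

Sufficiency: the nodes of an active path from `W` to `U` carry signs, where a fork draws its sign at
random, a chain copies the sign of its predecessor, and a collider multiplies two signs and sends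
the product to `D`. These products and the sign of `W` reveal to `D` the last sign before `U`,
which the decision has to match. The sign of `W` is multiplied by a mask that is sent by `X`. If
the mask is `0`, then `D` observes the same values after all random signs are flipped, but the last
sign before `U` flips.
-/

namespace DAG

variable {V : Type*} {G : DAG V}

/-! ### Active walks -/

theorem Adj.asymm {a b : V} (h : G.Adj a b) : ¬ G.Adj b a := fun h' =>
  G.acyclic a (.tail (.single h) h')

theorem Adj.ne {a b : V} (h : G.Adj a b) : a ≠ b := by
  rintro rfl
  exact h.asymm h

theorem HasDirectedPath.not_adj {a b : V} (h : G.HasDirectedPath a b) : ¬ G.Adj b a := fun h' =>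
  G.acyclic a (.tail' h h')

theorem mem_family_self (v : V) : v ∈ G.family v := Set.mem_insert _ _

theorem skeleton_adj {a b : V} : G.skeleton.Adj a b ↔ G.Adj a b ∨ G.Adj b a := by
  rw [skeleton, SimpleGraph.fromRel_adj, and_iff_right_iff_imp]
  rintro (h | h)
  exacts [h.ne, h.ne.symm]

variable (G) in
/-- The ancestors of a set of nodes, which include the set itself. -/
def ancestors (Z : Set V) : Set V := {v | ∃ z ∈ Z, G.HasDirectedPath v z}

theorem subset_ancestors {Z : Set V} : Z ⊆ G.ancestors Z := fun z hz => ⟨z, hz, .refl⟩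

theorem ancestors_mono {Z Z' : Set V} (h : Z ⊆ Z') : G.ancestors Z ⊆ G.ancestors Z' :=
  fun _ ⟨z, hz, hp⟩ => ⟨z, h hz, hp⟩

theorem HasDirectedPath.mem_ancestors {Z : Set V} {v w : V} (h : G.HasDirectedPath v w)
    (hw : w ∈ G.ancestors Z) : v ∈ G.ancestors Z :=
  hw.imp fun _ hz => ⟨hz.1, h.trans hz.2⟩

theorem Adj.mem_ancestors {Z : Set V} {v w : V} (h : G.Adj v w) (hw : w ∈ G.ancestors Z) :
    v ∈ G.ancestors Z :=
  HasDirectedPath.mem_ancestors (.single h) hw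

variable (G) in
/-- The middle node of the triple `a, b, c` of consecutive nodes does not block it, given `Z`. The
chains and the forks are the triples in which an edge leaves the middle node. -/
def OpenAt (Z : Set V) (a b c : V) : Prop :=
  ((G.Adj b a ∨ G.Adj b c) → b ∉ Z) ∧ (G.Adj a b → G.Adj c b → b ∈ G.ancestors Z)

theorem openAt_iff {Z : Set V} {a b c : V} (hab : G.Adj a b ∨ G.Adj b a)
    (hbc : G.Adj b c ∨ G.Adj c b) :
    G.OpenAt Z a b c ↔
      ¬ ((((G.Adj a b ∧ G.Adj b c) ∨ (G.Adj c b ∧ G.Adj b a) ∨ (G.Adj b a ∧ G.Adj b c)) ∧ b ∈ Z) ∨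
      ((G.Adj a b ∧ G.Adj c b) ∧ b ∉ Z ∧ ∀ d, G.IsDescendant b d → d ∉ Z)) := by
  have mem_ancestors_iff : b ∈ G.ancestors Z ↔ ¬ (b ∉ Z ∧ ∀ d, G.IsDescendant b d → d ∉ Z) := by
    simp only [ancestors, Set.mem_ofPred_eq, HasDirectedPath, IsDescendant,
      Relation.reflTransGen_iff_eq_or_transGen]
    grind
  rw [OpenAt, mem_ancestors_iff]
  tauto

variable (G) in
/-- The first `n + 1` terms of the sequence `s` form a walk in the skeleton that is not blocked
by `Z`. The remaining terms of `s` are arbitrary. -/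
structure IsActive (Z : Set V) (n : ℕ) (s : ℕ → V) : Prop where
  adj : ∀ i < n, G.Adj (s i) (s (i + 1)) ∨ G.Adj (s (i + 1)) (s i)
  isOpen : ∀ i, i + 2 ≤ n → G.OpenAt Z (s i) (s (i + 1)) (s (i + 2))

theorem not_blocked_iff {Z : Set V} {x y : V} (p : G.skeleton.Walk x y) :
    ¬ G.Blocked Z p ↔ G.IsActive Z p.length p.getVert := by
  have hadj : ∀ i < p.length, G.Adj (p.getVert i) (p.getVert (i + 1)) ∨
      G.Adj (p.getVert (i + 1)) (p.getVert i) := fun i hi =>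
    skeleton_adj.1 (p.adj_getVert_succ hi)
  constructor
  · intro h
    refine ⟨hadj, fun i hi => ?_⟩
    rw [openAt_iff (hadj i (by omega)) (hadj (i + 1) (by omega))]
    exact fun h' => h ⟨i, hi, _, _, _, rfl, rfl, rfl, h'⟩
  · rintro h ⟨i, hi, _, _, _, rfl, rfl, rfl, h'⟩
    exact (openAt_iff (hadj i (by omega)) (hadj (i + 1) (by omega))).1 (h.isOpen i hi) h'

theorem exists_walk_of_adj (n : ℕ) (s : ℕ → V)
    (h : ∀ i < n, G.Adj (s i) (s (i + 1)) ∨ G.Adj (s (i + 1)) (s i)) :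
    ∃ p : G.skeleton.Walk (s 0) (s n), p.length = n ∧ ∀ k ≤ n, p.getVert k = s k := by
  induction n generalizing s with
  | zero =>
    refine ⟨.nil, rfl, fun k hk => ?_⟩
    obtain rfl : k = 0 := by omega
    rfl
  | succ n ih =>
    obtain ⟨p, hp, hv⟩ := ih (fun k => s (k + 1)) fun i hi => h (i + 1) (by omega)
    refine ⟨.cons (skeleton_adj.2 (h 0 (by omega))) p, by simp [hp], fun k hk => ?_⟩
    cases k with
    | zero => rfl
    | succ k => simpa using hv k (by omega)

namespace IsActive

variable {Z : Set V} {m n : ℕ} {s t : ℕ → V}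

theorem congr (h : G.IsActive Z n s) (hst : ∀ k ≤ n, t k = s k) : G.IsActive Z n t where
  adj i hi := by
    rw [hst i (by omega), hst (i + 1) (by omega)]
    exact h.adj i hi
  isOpen i hi := by
    rw [hst i (by omega), hst (i + 1) (by omega), hst (i + 2) (by omega)]
    exact h.isOpen i hi

theorem take (h : G.IsActive Z n s) (hm : m ≤ n) : G.IsActive Z m s where
  adj i hi := h.adj i (by omega)
  isOpen i hi := h.isOpen i (by omega)

theorem drop (h : G.IsActive Z n s) (j : ℕ) : G.IsActive Z (n - j) (fun k => s (j + k)) where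
  adj i hi := h.adj (j + i) (by omega)
  isOpen i hi := h.isOpen (j + i) (by omega)

theorem cons (h : G.IsActive Z n s) {a : V} (ha : G.Adj a (s 0) ∨ G.Adj (s 0) a)
    (ho : 1 ≤ n → G.OpenAt Z a (s 0) (s 1)) :
    G.IsActive Z (n + 1) (fun k => Nat.casesOn k a s) where
  adj
    | 0, _ => ha
    | i + 1, hi => h.adj i (by omega)
  isOpen
    | 0, hi => ho (by omega)
    | i + 1, hi => h.isOpen i (by omega)

theorem append (hs : G.IsActive Z m s) (ht : G.IsActive Z n t) (hst : s m = t 0)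
    (ho : ∀ i, i + 1 = m → 1 ≤ n → G.OpenAt Z (s i) (s m) (t 1)) :
    G.IsActive Z (m + n) (fun k => if k ≤ m then s k else t (k - m)) := by
  have eq_right : ∀ k, (if m + k ≤ m then s (m + k) else t (m + k - m)) = t k := by
    rintro (_ | k)
    · simpa using hst
    · simp
  refine ⟨fun i hi => ?_, fun i hi => ?_⟩
  · rcases Nat.lt_or_ge i m with him | him
    · simpa [him.le, Nat.succ_le_of_lt him] using hs.adj i him
    · obtain ⟨k, rfl⟩ := Nat.exists_eq_add_of_le him
      simpa only [add_assoc, eq_right] using ht.adj k (by omega)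
  · rcases lt_trichotomy (i + 1) m with him | him | him
    · simpa [him.le, show i ≤ m by omega, show i + 2 ≤ m by omega] using hs.isOpen i him
    · subst him
      simpa [show i + 2 - (i + 1) = 1 by omega] using ho i rfl (by omega)
    · obtain ⟨k, rfl⟩ := Nat.exists_eq_add_of_le (show m ≤ i by omega)
      simpa only [add_assoc, eq_right] using ht.isOpen k (by omega)

/-- Following the walk from `s i` along the edges, the first edge that points backwards gives a
collider below `s i`, and there is one because `G` is acyclic. -/
theorem mem_ancestors_of_eq (h : G.IsActive Z n s) {i j : ℕ} (hij : i < j) (hj : j ≤ n)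
    (he : s i = s j) (h0 : G.Adj (s i) (s (i + 1))) : s i ∈ G.ancestors Z := by
  by_contra hno
  have forward : ∀ k, i + k + 1 ≤ j →
      Relation.TransGen G.Adj (s i) (s (i + k + 1)) ∧ G.Adj (s (i + k)) (s (i + k + 1)) := by
    intro k
    induction k with
    | zero => exact fun _ => ⟨.single h0, h0⟩
    | succ k ih =>
      intro hk
      obtain ⟨hpath, hlast⟩ := ih (by omega)
      rcases h.adj (i + k + 1) (by omega) with hnext | hnext
      · exact ⟨.tail hpath hnext, hnext⟩
      · exact absurd (HasDirectedPath.mem_ancestors hpath.to_reflTransGen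
          ((h.isOpen (i + k) (by omega)).2 hlast hnext)) hno
  obtain ⟨k, rfl⟩ := Nat.exists_eq_add_of_lt hij
  exact G.acyclic _ (he ▸ (forward k le_rfl).1)

theorem openAt_of_eq (h : G.IsActive Z n s) {i j : ℕ} (hij : i + 1 < j) (hj : j < n)
    (he : s (i + 1) = s j) : G.OpenAt Z (s i) (s (i + 1)) (s (j + 1)) := by
  constructor
  · rintro (hback | hforth)
    · exact (h.isOpen i (by omega)).1 (Or.inl hback)
    · obtain ⟨k, rfl⟩ := Nat.exists_eq_add_of_lt hij
      rw [he] at hforth ⊢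
      exact (h.isOpen _ (by omega)).1 (Or.inr hforth)
  · intro hin _
    rcases h.adj (i + 1) (by omega) with hout | hin'
    · exact h.mem_ancestors_of_eq hij hj.le he hout
    · exact (h.isOpen i (by omega)).2 hin hin'

theorem exists_shorter_of_eq (h : G.IsActive Z n s) {i j : ℕ} (hij : i < j) (hj : j ≤ n)
    (he : s i = s j) :
    ∃ m < n, ∃ t : ℕ → V, t 0 = s 0 ∧ t m = s n ∧ G.IsActive Z m t := by
  refine ⟨i + (n - j), by omega, _, by simp, ?_,
    (h.take (by omega)).append (h.drop j) (by simpa using he) ?_⟩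
  · obtain ⟨k, rfl⟩ := Nat.exists_eq_add_of_le hj
    rcases k with _ | k
    · simpa using he
    · simp [show j + (k + 1) - j = k + 1 by omega]
  · rintro i rfl hn
    exact h.openAt_of_eq hij (by omega) he

theorem exists_injOn (h : G.IsActive Z n s) {N : Set V} (h0 : s 0 ∈ N) :
    ∃ (m : ℕ) (t : ℕ → V), t 0 ∈ N ∧ t m = s n ∧ G.IsActive Z m t ∧ Set.InjOn t {k | k ≤ m} ∧
      ∀ k, 0 < k → k ≤ m → t k ∉ N := by
  classical
  have hex : ∃ (m : ℕ) (t : ℕ → V), t 0 ∈ N ∧ t m = s n ∧ G.IsActive Z m t := ⟨n, s, h0, rfl, h⟩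
  obtain ⟨t, ht0, htm, ht⟩ := Nat.find_spec hex
  have hmin := fun m (hm : m < Nat.find hex) => Nat.find_min hex hm
  generalize Nat.find hex = m at *
  have hinj : ∀ i j, i < j → j ≤ m → t i ≠ t j := fun i j hij hj he =>
    let ⟨l, hl, r, hr0, hrl, hr⟩ := ht.exists_shorter_of_eq hij hj he
    hmin l hl ⟨r, hr0 ▸ ht0, hrl.trans htm, hr⟩
  refine ⟨m, t, ht0, htm, ht, fun i hi j hj hij => ?_, fun k hk hkm hkN => ?_⟩
  · rcases lt_trichotomy i j with hlt | he | hlt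
    · exact absurd hij (hinj i j hlt hj)
    · exact he
    · exact absurd hij.symm (hinj j i hlt hi)
  · exact hmin (m - k) (by omega) ⟨_, hkN, by simpa [Nat.add_sub_cancel' hkm] using htm, ht.drop k⟩

end IsActive

theorem dConn_singleton_iff {Z : Set V} {x y : V} :
    G.DConn {x} {y} Z ↔
      ∃ (n : ℕ) (s : ℕ → V), s 0 = x ∧ s n = y ∧ G.IsActive Z n s ∧ Set.InjOn s {k | k ≤ n} := by
  simp only [DConn, DSep, Set.mem_singleton_iff, forall_eq, not_forall]
  constructor
  · rintro ⟨p, hp, h⟩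
    exact ⟨p.length, p.getVert, by simp, by simp, (not_blocked_iff p).1 h, hp.getVert_injOn⟩
  · rintro ⟨n, s, rfl, rfl, h, hinj⟩
    obtain ⟨p, hp, hv⟩ := exists_walk_of_adj n s h.adj
    refine ⟨p, ?_, ?_⟩
    · rw [← SimpleGraph.Walk.IsPath.getVert_injOn_iff, hp]
      exact hinj.congr fun k hk => (hv k hk).symm
    · rw [not_blocked_iff, hp]
      exact h.congr hv

theorem exists_dConn_of_isActive {F N : Set V} {n : ℕ} {s : ℕ → V}
    (h : G.IsActive (F \ N) n s) (h0 : s 0 ∈ N) :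
    ∃ w ∈ N, G.DConn {w} {s n} (F \ {w}) := by
  obtain ⟨m, t, ht0, htm, ht, hinj, hN⟩ := h.exists_injOn h0
  refine ⟨t 0, ht0, dConn_singleton_iff.2 ⟨m, t, rfl, htm, ⟨ht.adj, fun i hi => ⟨?_, ?_⟩⟩, hinj⟩⟩
  · exact fun hout hF => (ht.isOpen i hi).1 hout ⟨hF.1, hN _ (by omega) (by omega)⟩
  · have hsub : F \ N ⊆ F \ {t 0} := Set.sdiff_subset_sdiff_right (Set.singleton_subset_iff.2 ht0)
    exact fun hin hin' => ancestors_mono hsub ((ht.isOpen i hi).2 hin hin')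

/-! ### Separation in the moral graph -/

variable (G) in
/-- The nodes outside `Z` from which there is an active walk to `u`. -/
def activeTo (Z : Set V) (u : V) : Set V :=
  {v | v ∉ Z ∧ ∃ (n : ℕ) (s : ℕ → V), s 0 = v ∧ s n = u ∧ G.IsActive Z n s}

variable (G) in
/-- Outside `Z`, the set `B` is closed under adjacency in the moral graph of the subgraph on `R`,
in which the members of each family are pairwise adjacent. -/
def MorallyClosed (Z R B : Set V) : Prop :=
  ∀ w ∈ R, ∀ a ∈ G.family w, ∀ b ∈ G.family w, a ∉ Z → b ∈ B → a ∈ B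

theorem mem_activeTo_self {Z : Set V} {u : V} (h : u ∉ Z) : u ∈ G.activeTo Z u :=
  ⟨h, 0, fun _ => u, rfl, rfl, ⟨by simp, by simp⟩⟩

theorem disjoint_activeTo {F N : Set V} {u : V} (h : ∀ w ∈ N, ¬ G.DConn {w} {u} (F \ {w})) :
    Disjoint F (G.activeTo (F \ N) u) := by
  refine Set.disjoint_left.2 ?_
  rintro _ hF ⟨hZ, n, s, rfl, rfl, hs⟩
  obtain ⟨w, hw, hconn⟩ := exists_dConn_of_isActive hs (by_contra fun hN => hZ ⟨hF, hN⟩)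
  exact h w hw hconn

theorem HasDirectedPath.exists_isActive {Z : Set V} {w u : V} (h : G.HasDirectedPath w u)
    (hw : w ∉ G.ancestors Z) :
    ∃ (n : ℕ) (s : ℕ → V), s 0 = w ∧ s n = u ∧ G.IsActive Z n s ∧
      (1 ≤ n → G.Adj (s 0) (s 1)) := by
  induction h using Relation.ReflTransGen.head_induction_on with
  | refl => exact ⟨0, fun _ => u, rfl, rfl, ⟨by simp, by simp⟩, by simp⟩
  | @head a c hac hcu ih =>
    have hc : c ∉ G.ancestors Z := fun hc => hw (hac.mem_ancestors hc)
    obtain ⟨n, s, rfl, rfl, hs, hout⟩ := ih hc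
    exact ⟨n + 1, _, rfl, rfl, hs.cons (Or.inl hac) fun hn =>
      ⟨fun _ hz => hc (subset_ancestors hz), fun _ hin => absurd hin (hout hn).asymm⟩,
      fun _ => hac⟩

/-- If the walk cannot be extended to the parent `a` because it has a blocked collider at its first
node, then that node is an ancestor of `u`, and a directed path to `u` replaces the walk. -/
theorem IsActive.exists_of_adj {Z : Set V} {n : ℕ} {s : ℕ → V} {a : V} (h : G.IsActive Z n s)
    (hR : s 0 ∈ G.ancestors (insert (s n) Z)) (hZ : 1 ≤ n → s 0 ∈ Z → G.Adj (s 1) (s 0))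
    (ha : G.Adj a (s 0)) :
    ∃ (m : ℕ) (t : ℕ → V), t 0 = a ∧ t m = s n ∧ G.IsActive Z m t := by
  by_cases hanc : s 0 ∈ G.ancestors Z
  · refine ⟨n + 1, _, rfl, rfl, h.cons (Or.inl ha) fun hn => ⟨?_, fun _ _ => hanc⟩⟩
    rintro (hback | hout) hmem
    · exact ha.asymm hback
    · exact (hZ hn hmem).asymm hout
  · have hpath : G.HasDirectedPath (s 0) (s n) := by
      obtain ⟨z, rfl | hz, hp⟩ := hR
      · exact hp
      · exact absurd ⟨z, hz, hp⟩ hanc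
    obtain ⟨m, t, ht0, htm, ht, hout⟩ := hpath.exists_isActive hanc
    refine ⟨m + 1, _, rfl, htm, ht.cons (Or.inl (ht0 ▸ ha)) fun hm => ⟨fun _ hmem => ?_, ?_⟩⟩
    · exact hanc (subset_ancestors (ht0 ▸ hmem))
    · exact fun _ hin => absurd hin (hout hm).asymm

theorem morallyClosed_activeTo (Z : Set V) (u : V) :
    G.MorallyClosed Z (G.ancestors (insert u Z)) (G.activeTo Z u) := by
  rintro w hw a ha _ hb haZ ⟨hbZ, n, s, rfl, rfl, hs⟩
  refine ⟨haZ, ?_⟩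
  rcases hb with rfl | hb
  · rcases ha with rfl | ha
    · exact ⟨n, s, rfl, rfl, hs⟩
    · exact hs.exists_of_adj hw (fun _ h => absurd h hbZ) ha
  · have hsw : G.IsActive Z (n + 1) (fun k => Nat.casesOn k w s) :=
      hs.cons (Or.inr hb) fun _ => ⟨fun _ => hbZ, fun h => absurd h (Adj.asymm hb)⟩
    rcases ha with rfl | ha
    · exact ⟨n + 1, _, rfl, rfl, hsw⟩
    · exact hsw.exists_of_adj hw (fun _ _ => hb) ha

variable (G) in
/-- The nodes whose family meets `B`: the members of `B` and their children. -/
def withChildren (B : Set V) : Set V := {v | ∃ b ∈ G.family v, b ∈ B}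

end DAG

/-! ### Exchanging exogenous variables -/

namespace SCM

variable {V : Type*} [Fintype V] {G : DAG V} (M : SCM G)

theorem eq_eval {e : ∀ v, M.Exo v} {x : ∀ v, M.Dom v}
    (h : ∀ v, x v = M.f v (fun w => x w.1) (e v)) (v : V) : x v = M.eval e v := by
  induction v using G.wellFounded_adj.induction with
  | _ v ih =>
    rw [h, M.eval_eq]
    congr 1
    funext w
    exact ih w.1 w.2

theorem potentialResponse_of_ne [DecidableEq V] (X : V) (x : M.Dom X) (e : ∀ v, M.Exo v) {v : V}
    (hv : v ≠ X) :
    M.potentialResponse X x e v = M.f v (fun w => M.potentialResponse X x e w.1) (e v) := by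
  rw [potentialResponse, eval_eq]
  exact congrFun (congrFun (M.intervene_f_of_ne X x v hv) _) _

theorem potentialResponse_eq_eval [DecidableEq V] (X : V) (x : M.Dom X) (e : ∀ v, M.Exo v) {v : V}
    (hv : ¬ G.HasDirectedPath X v) : M.potentialResponse X x e v = M.eval e v := by
  induction v using G.wellFounded_adj.induction with
  | _ v ih =>
    rw [M.potentialResponse_of_ne X x e (fun h => hv (h ▸ .refl)), M.eval_eq]
    congr 1
    funext w
    exact ih w.1 w.2 fun h => hv (h.tail w.2)

/-- If `B` and its complement are separated by `Z` in the moral graph of `R`, then the nodes of `B`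
follow the exogenous variables of the families that meet `B`, the nodes outside `B` follow the
other ones, and those in `Z`, where the two settings agree, follow both. -/
theorem eval_piecewise {Z R B : Set V} [DecidablePred (· ∈ G.withChildren B)]
    (hR : ∀ v ∈ R, G.parents v ⊆ R) (hB : G.MorallyClosed Z R B) {e e' : ∀ v, M.Exo v}
    (hZ : ∀ v ∈ Z, M.eval e v = M.eval e' v) {v : V} (hv : v ∈ R) :
    (v ∈ B ∪ Z → M.eval ((G.withChildren B).piecewise e e') v = M.eval e v) ∧
      (v ∉ B → M.eval ((G.withChildren B).piecewise e e') v = M.eval e' v) := by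
  induction v using G.wellFounded_adj.induction with
  | _ v ih =>
    by_cases hS : v ∈ G.withChildren B
    · have hclosed : ∀ a ∈ G.family v, a ∉ Z → a ∈ B := fun a ha haZ =>
        let ⟨b, hb, hbB⟩ := hS
        hB v hv a ha b hb haZ hbB
      have eq_left : M.eval ((G.withChildren B).piecewise e e') v = M.eval e v := by
        rw [M.eval_eq, M.eval_eq e, Set.piecewise_eq_of_mem _ _ _ hS]
        congr 1
        funext w
        refine (ih w.1 w.2 (hR v hv w.2)).1 ?_
        exact (em (w.1 ∈ Z)).elim Or.inr fun hw => Or.inl (hclosed w.1 (Or.inr w.2) hw)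
      refine ⟨fun _ => eq_left, fun hvB => eq_left.trans (hZ v ?_)⟩
      exact not_not.1 fun hvZ => hvB (hclosed v (DAG.mem_family_self v) hvZ)
    · have eq_right : M.eval ((G.withChildren B).piecewise e e') v = M.eval e' v := by
        rw [M.eval_eq, M.eval_eq e', Set.piecewise_eq_of_notMem _ _ _ hS]
        congr 1
        funext w
        exact (ih w.1 w.2 (hR v hv w.2)).2 fun hwB => hS ⟨w.1, Or.inr w.2, hwB⟩
      refine ⟨fun hvBZ => eq_right.trans (hZ v ?_).symm, fun _ => eq_right⟩
      exact hvBZ.resolve_left fun hvB => hS ⟨v, DAG.mem_family_self v, hvB⟩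

end SCM

namespace MutuallyIndependent

variable {V : Type*} [Fintype V] {Exo : V → Type} {P : PMF (∀ v, Exo v)}

theorem toReal_piecewise_mul (hP : MutuallyIndependent P) (S : Set V) [DecidablePred (· ∈ S)]
    (e e' : ∀ v, Exo v) :
    (P (S.piecewise e e')).toReal * (P (S.piecewise e' e)).toReal =
      (P e).toReal * (P e').toReal := by
  simp only [hP _, ENNReal.toReal_prod, ← Finset.prod_mul_distrib]
  refine Finset.prod_congr rfl fun v _ => ?_
  by_cases h : v ∈ S <;> simp [h, mul_comm]

/-- Conditional independence of `g` and the event `F` given `Ω`: exchanging the coordinates in `S`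
of two settings matches the terms of the two sides. -/
theorem sum_mul_sum_eq (hP : MutuallyIndependent P) (S : Set V) [DecidablePred (· ∈ S)]
    {Ω F : Finset (∀ v, Exo v)} {g : (∀ v, Exo v) → ℝ} (hFΩ : F ⊆ Ω)
    (hΩ : ∀ e ∈ Ω, ∀ e' ∈ Ω, S.piecewise e e' ∈ Ω) (hF : ∀ e ∈ Ω, ∀ e' ∈ F, S.piecewise e e' ∈ F)
    (hg : ∀ e ∈ Ω, ∀ e' ∈ Ω, g (S.piecewise e e') = g e) :
    (∑ e ∈ F, (P e).toReal * g e) * ∑ e ∈ Ω, (P e).toReal =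
      (∑ e ∈ Ω, (P e).toReal * g e) * ∑ e ∈ F, (P e).toReal := by
  have piecewise_piecewise : ∀ e e' : ∀ v, Exo v,
      S.piecewise (S.piecewise e e') (S.piecewise e' e) = e := by
    intro e e'
    ext v
    by_cases h : v ∈ S <;> simp [h]
  rw [Finset.sum_mul_sum, Finset.sum_mul_sum, ← Finset.sum_product', ← Finset.sum_product']
  refine Finset.sum_nbij' (fun x => (S.piecewise x.1 x.2, S.piecewise x.2 x.1))
    (fun x => (S.piecewise x.1 x.2, S.piecewise x.2 x.1)) ?_ ?_ ?_ ?_ ?_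
  · rintro ⟨e, e'⟩ h
    obtain ⟨he, he'⟩ := Finset.mem_product.1 h
    exact Finset.mem_product.2 ⟨hΩ e (hFΩ he) e' he', hF e' he' e he⟩
  · rintro ⟨e, e'⟩ h
    obtain ⟨he, he'⟩ := Finset.mem_product.1 h
    exact Finset.mem_product.2 ⟨hF e he e' he', hΩ e' (hFΩ he') e he⟩
  · exact fun x _ => by simp only [piecewise_piecewise]
  · exact fun x _ => by simp only [piecewise_piecewise]
  · rintro ⟨e, e'⟩ h
    obtain ⟨he, he'⟩ := Finset.mem_product.1 h
    rw [hg e (hFΩ he) e' he']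
    linear_combination (-g e) * hP.toReal_piecewise_mul S e e'

end MutuallyIndependent

/-! ### The values of the nodes under a policy -/

theorem CID.IsSingleDecision.kind_ne_decision {V : Type*} {C : CID V} {D : V}
    (hD : C.IsSingleDecision D) {v : V} (h : v ≠ D) : C.kind v ≠ NodeKind.decision :=
  fun h' => h ((hD v).1 h')

theorem CID.IsSingleDecision.ne_of_utility {V : Type*} {C : CID V} {D : V}
    (hD : C.IsSingleDecision D) {u : V} (hu : C.kind u = NodeKind.utility) : u ≠ D := by
  rintro rfl
  simp [(hD u).2 rfl] at hu

namespace SCIM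

variable {V : Type*} [Fintype V] {C : CID V} (M : SCIM C) {D : V} (hD : C.IsSingleDecision D)

/-- The value of the node `v` under the policy `π`. -/
noncomputable def value (π : M.Policy D) (e : ∀ v, M.Exo v) (v : V) : M.Dom v :=
  (M.withPolicy hD π).eval e v

theorem value_decision (π : M.Policy D) (e : ∀ v, M.Exo v) :
    M.value hD π e D = π (fun w => M.value hD π e w.1) (e D) := by
  rw [value, SCM.eval_eq]
  exact congrFun (congrFun (M.withPolicy_f_decision hD π) _) _

theorem value_of_ne (π : M.Policy D) (e : ∀ v, M.Exo v) {v : V} (hv : v ≠ D) :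
    M.value hD π e v =
      M.f v (hD.kind_ne_decision hv) (fun w => M.value hD π e w.1) (e v) := by
  rw [value, SCM.eval_eq]
  exact congrFun (congrFun (M.withPolicy_f_of_ne hD π v (hD.kind_ne_decision hv)) _) _

theorem value_congr {π π' : M.Policy D} {e : ∀ v, M.Exo v} {S : Set V}
    (hS : ∀ v ∈ S, C.parents v ⊆ S) (hDS : D ∈ S → M.value hD π e D = M.value hD π' e D) {v : V}
    (hv : v ∈ S) : M.value hD π e v = M.value hD π' e v := by
  induction v using C.wellFounded_adj.induction with
  | _ v ih =>
    by_cases hvD : v = D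
    · subst hvD
      exact hDS hv
    · rw [value_of_ne M hD π e hvD, value_of_ne M hD π' e hvD]
      congr 1
      funext w
      exact ih w.1 w.2 (hS v hv w.2)

theorem value_eq_of_not_hasDirectedPath (π π' : M.Policy D) (e : ∀ v, M.Exo v) {v : V}
    (hv : ¬ C.HasDirectedPath D v) : M.value hD π e v = M.value hD π' e v :=
  M.value_congr hD (S := {v | ¬ C.HasDirectedPath D v}) (fun _ h _ hw h' => h (h'.tail hw))
    (fun h => absurd .refl h) hv

variable {M} in
/-- The policy that always decides `d`. -/
def constPolicy (d : M.Dom D) : M.Policy D := fun _ _ => d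

/-- What every policy observes at the setting `e`: the values of the parents of the decision. -/
noncomputable def observation (e : ∀ v, M.Exo v) (w : C.parents D) : M.Dom w :=
  M.value hD (constPolicy (Classical.arbitrary _)) e w

theorem value_parents (π : M.Policy D) (e : ∀ v, M.Exo v) (w : C.parents D) :
    M.value hD π e w = M.observation hD e w :=
  M.value_eq_of_not_hasDirectedPath hD _ _ e fun h => h.not_adj w.2

theorem value_constPolicy_decision (d : M.Dom D) (e : ∀ v, M.Exo v) :
    M.value hD (constPolicy d) e D = d :=
  M.value_decision hD _ e

theorem value_decision_eq_observation (π : M.Policy D) (e : ∀ v, M.Exo v) :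
    M.value hD π e D = π (M.observation hD e) (e D) := by
  rw [value_decision]
  congr 1
  funext w
  exact M.value_parents hD π e w

theorem totalUtility_eq (π : M.Policy D) (e : ∀ v, M.Exo v) :
    M.totalUtility hD π e =
      M.totalUtility hD (constPolicy (π (M.observation hD e) (e D))) e :=
  Finset.sum_congr rfl fun u _ => congrArg (M.util u.1 u.2) <|
    M.value_congr hD (S := Set.univ) (fun _ _ => Set.subset_univ _) (fun _ => by
      rw [value_constPolicy_decision, value_decision_eq_observation]) (Set.mem_univ _)

theorem IsOptimal.totalUtility_eq_of_le [DecidableEq V] {M : SCIM C} {hD : C.IsSingleDecision D}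
    {π ρ : M.Policy D} (hπ : M.IsOptimal hD π)
    (hle : ∀ e, M.totalUtility hD π e ≤ M.totalUtility hD ρ e) {e : ∀ v, M.Exo v}
    (he : M.P e ≠ 0) : M.totalUtility hD π e = M.totalUtility hD ρ e := by
  have hterm : ∀ e ∈ Finset.univ, (M.P e).toReal * M.totalUtility hD π e ≤
      (M.P e).toReal * M.totalUtility hD ρ e := fun e _ =>
    mul_le_mul_of_nonneg_left (hle e) ENNReal.toReal_nonneg
  have hsum := (Finset.sum_eq_sum_iff_of_le hterm).1 ((Finset.sum_le_sum hterm).antisymm (hπ ρ))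
  exact mul_left_cancel₀ (ENNReal.toReal_ne_zero.2 ⟨he, M.P.apply_ne_top e⟩)
    (hsum e (Finset.mem_univ e))

/-! ### Optimal policies ignore d-separated parents -/

variable [DecidableEq V]

open Classical in
/-- The settings at which a policy takes its decision on seeing the values `p` of the parents and
the exogenous value `ε`. -/
noncomputable def seeing (p : ∀ w : C.parents D, M.Dom w) (ε : M.Exo D) :
    Finset (∀ v, M.Exo v) :=
  {e | M.observation hD e = p ∧ e D = ε}

open Classical in
/-- The settings at which the parents of the decision outside `N` have the values `p`. -/
noncomputable def agreeing (N : Set V) (p : ∀ w : C.parents D, M.Dom w) :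
    Finset (∀ v, M.Exo v) :=
  {e | ∀ w : C.parents D, w.1 ∉ N → M.observation hD e w = p w}

/-- The expected total utility of the decision `d` on the event `Ω`, without normalization. -/
noncomputable def utilityOn (Ω : Finset (∀ v, M.Exo v)) (d : M.Dom D) : ℝ :=
  ∑ e ∈ Ω, (M.P e).toReal * M.totalUtility hD (constPolicy d) e

variable {M hD} in
theorem mem_seeing {p : ∀ w : C.parents D, M.Dom w} {ε : M.Exo D} {e : ∀ v, M.Exo v} :
    e ∈ M.seeing hD p ε ↔ M.observation hD e = p ∧ e D = ε := by
  simp [seeing]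

variable {M hD} in
theorem mem_agreeing {N : Set V} {p : ∀ w : C.parents D, M.Dom w} {e : ∀ v, M.Exo v} :
    e ∈ M.agreeing hD N p ↔ ∀ w : C.parents D, w.1 ∉ N → M.observation hD e w = p w := by
  simp [agreeing]

theorem seeing_subset_agreeing (N : Set V) (p : ∀ w : C.parents D, M.Dom w) (ε : M.Exo D) :
    M.seeing hD p ε ⊆ M.agreeing hD N p := fun _ he =>
  mem_agreeing.2 fun w _ => congrFun (mem_seeing.1 he).1 w

theorem agreeing_congr {N : Set V} {p p' : ∀ w : C.parents D, M.Dom w}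
    (h : ∀ w : C.parents D, w.1 ∉ N → p w = p' w) : M.agreeing hD N p = M.agreeing hD N p' := by
  ext e
  simp only [mem_agreeing]
  exact forall₂_congr fun w hw => by rw [h w hw]

variable {M hD} in
theorem value_eq_of_mem_agreeing {N : Set V} {p : ∀ w : C.parents D, M.Dom w}
    {e e' : ∀ v, M.Exo v} (he : e ∈ M.agreeing hD N p) (he' : e' ∈ M.agreeing hD N p)
    (d : M.Dom D) {v : V} (hv : v ∈ C.family D \ N) :
    M.value hD (constPolicy d) e v = M.value hD (constPolicy d) e' v := by
  obtain ⟨rfl | hvD, hvN⟩ := hv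
  · simp only [value_constPolicy_decision]
  · exact (M.value_parents hD _ e ⟨v, hvD⟩).trans <|
      (mem_agreeing.1 he _ hvN).trans <| (mem_agreeing.1 he' _ hvN).symm.trans
        (M.value_parents hD _ e' ⟨v, hvD⟩).symm

theorem expectedUtility_eq_sum_utilityOn [Fintype (∀ w : C.parents D, M.Dom w)]
    (π : M.Policy D) :
    M.expectedUtility hD π =
      ∑ o : (∀ w : C.parents D, M.Dom w) × M.Exo D,
        M.utilityOn hD (M.seeing hD o.1 o.2) (π o.1 o.2) := by
  classical
  rw [expectedUtility, ← Finset.sum_fiberwise _ fun e => (M.observation hD e, e D)]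
  refine Finset.sum_congr rfl fun o _ => ?_
  have hfiber : Finset.univ.filter (fun e => (M.observation hD e, e D) = o) =
      M.seeing hD o.1 o.2 := by
    ext e
    simp [mem_seeing, Prod.ext_iff]
  rw [hfiber]
  refine Finset.sum_congr rfl fun e he => ?_
  rw [M.totalUtility_eq, (mem_seeing.1 he).1, (mem_seeing.1 he).2]

theorem isOptimal_of_forall_le {π : M.Policy D}
    (h : ∀ p ε d, M.utilityOn hD (M.seeing hD p ε) d ≤
      M.utilityOn hD (M.seeing hD p ε) (π p ε)) : M.IsOptimal hD π := by
  have := Fintype.ofFinite (∀ w : C.parents D, M.Dom w)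
  intro π'
  rw [expectedUtility_eq_sum_utilityOn, expectedUtility_eq_sum_utilityOn]
  exact Finset.sum_le_sum fun o _ => h o.1 o.2 _

section Screening

variable {N : Set V} (hDN : D ∉ N)

include hDN

/-- A node `u` that is d-separated from the parents in `N`, as a function of the decision, is
independent of them and of the exogenous variable of `D`, given the other parents. -/
theorem sum_seeing_mul_sum_agreeing {u : V} (hu : u ∉ C.family D)
    (hsep : ∀ w ∈ N, ¬ C.DConn {w} {u} (C.family D \ {w})) (g : (M.Dom D → M.Dom u) → ℝ)
    (p : ∀ w : C.parents D, M.Dom w) (ε : M.Exo D) :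
    (∑ e ∈ M.seeing hD p ε, (M.P e).toReal * g fun d => M.value hD (constPolicy d) e u) *
        ∑ e ∈ M.agreeing hD N p, (M.P e).toReal =
      (∑ e ∈ M.agreeing hD N p, (M.P e).toReal * g fun d => M.value hD (constPolicy d) e u) *
        ∑ e ∈ M.seeing hD p ε, (M.P e).toReal := by
  classical
  set Z := C.family D \ N
  set B := C.activeTo Z u
  set R := C.ancestors (insert u Z)
  have hR : ∀ v ∈ R, C.parents v ⊆ R := fun v hv w hw => DAG.Adj.mem_ancestors hw hv
  have hDR : D ∈ R := DAG.subset_ancestors (Or.inr ⟨DAG.mem_family_self D, hDN⟩)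
  have hdisj : Disjoint (C.family D) B := DAG.disjoint_activeTo hsep
  have hDS : D ∉ C.withChildren B := fun ⟨b, hb, hbB⟩ => Set.disjoint_left.1 hdisj hb hbB
  have markov : ∀ e ∈ M.agreeing hD N p, ∀ e' ∈ M.agreeing hD N p, ∀ d, ∀ v ∈ R,
      (v ∈ B ∪ Z → M.value hD (constPolicy d) ((C.withChildren B).piecewise e e') v =
        M.value hD (constPolicy d) e v) ∧
      (v ∉ B → M.value hD (constPolicy d) ((C.withChildren B).piecewise e e') v =
        M.value hD (constPolicy d) e' v) :=
    fun e he e' he' d v hv => (M.withPolicy hD (constPolicy d)).eval_piecewise hR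
      (DAG.morallyClosed_activeTo Z u) (fun w hw => value_eq_of_mem_agreeing he he' d hw) hv
  have observation_eq : ∀ e ∈ M.agreeing hD N p, ∀ e' ∈ M.agreeing hD N p,
      M.observation hD ((C.withChildren B).piecewise e e') = M.observation hD e' :=
    fun e he e' he' => funext fun w => (markov e he e' he' _ w (hR D hDR w.2)).2
      (Set.disjoint_left.1 hdisj (Or.inr w.2))
  refine MutuallyIndependent.sum_mul_sum_eq M.indep (C.withChildren B)
    (M.seeing_subset_agreeing hD N p ε) ?_ ?_ ?_
  · intro e he e' he'
    rw [mem_agreeing, observation_eq e he e' he']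
    exact mem_agreeing.1 he'
  · intro e he e' he'
    rw [mem_seeing, observation_eq e he e' (M.seeing_subset_agreeing hD N p ε he'),
      Set.piecewise_eq_of_notMem _ _ _ hDS]
    exact mem_seeing.1 he'
  · intro e he e' he'
    refine congrArg g (funext fun d => ?_)
    exact (markov e he e' he' d u (DAG.subset_ancestors (Or.inl rfl))).1
      (Or.inl (DAG.mem_activeTo_self fun h => hu h.1))

variable (hsep : ∀ w ∈ N, ∀ u, C.kind u = NodeKind.utility → C.HasDirectedPath D u →
  ¬ C.DConn {w} {u} (C.family D \ {w}))

include hsep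

theorem utilityOn_seeing_sub_mul (p : ∀ w : C.parents D, M.Dom w) (ε : M.Exo D)
    (d d' : M.Dom D) :
    (M.utilityOn hD (M.seeing hD p ε) d - M.utilityOn hD (M.seeing hD p ε) d') *
        ∑ e ∈ M.agreeing hD N p, (M.P e).toReal =
      (M.utilityOn hD (M.agreeing hD N p) d - M.utilityOn hD (M.agreeing hD N p) d') *
        ∑ e ∈ M.seeing hD p ε, (M.P e).toReal := by
  let difference (e : ∀ v, M.Exo v) (u : {u // C.kind u = NodeKind.utility}) : ℝ :=
    M.util u.1 u.2 (M.value hD (constPolicy d) e u) -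
      M.util u.1 u.2 (M.value hD (constPolicy d') e u)
  have utilityOn_sub : ∀ Ω : Finset (∀ v, M.Exo v),
      M.utilityOn hD Ω d - M.utilityOn hD Ω d' = ∑ u, ∑ e ∈ Ω, (M.P e).toReal * difference e u := by
    intro Ω
    rw [Finset.sum_comm, utilityOn, utilityOn, ← Finset.sum_sub_distrib]
    simp only [← Finset.mul_sum, ← mul_sub, totalUtility, ← Finset.sum_sub_distrib, difference,
      value]
  rw [utilityOn_sub, utilityOn_sub, Finset.sum_mul, Finset.sum_mul]
  refine Finset.sum_congr rfl fun u _ => ?_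
  by_cases hDu : C.HasDirectedPath D u.1
  · have hu : u.1 ∉ C.family D := fun h => h.elim (hD.ne_of_utility u.2)
      (C.utility_no_children u.1 D u.2)
    exact M.sum_seeing_mul_sum_agreeing hD hDN hu (fun w hw => hsep w hw u.1 u.2 hDu)
      (fun y => M.util u.1 u.2 (y d) - M.util u.1 u.2 (y d')) p ε
  · have difference_eq : ∀ e, difference e u = 0 := fun e => by
      simp only [difference,
        M.value_eq_of_not_hasDirectedPath hD (constPolicy d) (constPolicy d') e hDu, sub_self]
    simp [difference_eq]

theorem utilityOn_seeing_le {p : ∀ w : C.parents D, M.Dom w} {d d' : M.Dom D}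
    (h : M.utilityOn hD (M.agreeing hD N p) d' ≤ M.utilityOn hD (M.agreeing hD N p) d)
    (ε : M.Exo D) :
    M.utilityOn hD (M.seeing hD p ε) d' ≤ M.utilityOn hD (M.seeing hD p ε) d := by
  have hnonneg : ∀ Ω : Finset (∀ v, M.Exo v), 0 ≤ ∑ e ∈ Ω, (M.P e).toReal := fun Ω =>
    Finset.sum_nonneg fun _ _ => ENNReal.toReal_nonneg
  rcases (hnonneg (M.agreeing hD N p)).eq_or_lt with hzero | hpos
  · rw [eq_comm, Finset.sum_eq_zero_iff_of_nonneg fun _ _ => ENNReal.toReal_nonneg] at hzero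
    refine (Finset.sum_congr rfl fun e he => ?_).le
    rw [hzero e (M.seeing_subset_agreeing hD N p ε he), zero_mul, zero_mul]
  · refine sub_nonneg.1 (nonneg_of_mul_nonneg_left ?_ hpos)
    rw [M.utilityOn_seeing_sub_mul hD hDN hsep]
    exact mul_nonneg (sub_nonneg.2 h) (hnonneg _)

theorem exists_isOptimal_of_not_dConn :
    ∃ π : M.Policy D, M.IsOptimal hD π ∧
      ∀ p p' ε ε', (∀ w : C.parents D, w.1 ∉ N → p w = p' w) → π p ε = π p' ε' := by
  choose argmax hargmax using fun g : M.Dom D → ℝ => Finite.exists_max g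
  refine ⟨fun p _ => argmax (M.utilityOn hD (M.agreeing hD N p)), ?_, fun p p' _ _ h => ?_⟩
  · exact M.isOptimal_of_forall_le hD fun p ε d =>
      M.utilityOn_seeing_le hD hDN hsep (hargmax _ d) ε
  · simp only [M.agreeing_congr hD h]

end Screening

end SCIM

theorem CID.CompatibleWithResponseIncentive.exists_dConn {V : Type*} [Fintype V] [DecidableEq V]
    {C : CID V} {D : V} {hD : C.IsSingleDecision D} {X : V} (hX : X ≠ D)
    (h : C.CompatibleWithResponseIncentive hD X) :
    ∃ W U : V, W ∈ C.parents D ∧ C.kind U = NodeKind.utility ∧ C.HasDirectedPath X W ∧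
      C.HasDirectedPath D U ∧ C.DConn {W} {U} (C.family D \ {W}) := by
  obtain ⟨M, hM⟩ := h
  by_contra! hno
  let N : Set V := {w | w ∈ C.parents D ∧ ∀ u, C.kind u = NodeKind.utility →
    C.HasDirectedPath D u → ¬ C.DConn {w} {u} (C.family D \ {w})}
  have hDN : D ∉ N := fun h => DAG.Adj.ne h.1 rfl
  obtain ⟨π, hopt, hπ⟩ := M.exists_isOptimal_of_not_dConn hD hDN fun _ hw => hw.2
  obtain ⟨x, e, hne⟩ := hM π hopt
  refine hne ?_
  rw [(M.withPolicy hD π).potentialResponse_of_ne X x e hX.symm, SCM.eval_eq,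
    M.withPolicy_f_decision hD π]
  refine hπ _ _ _ _ fun w hw => (M.withPolicy hD π).potentialResponse_eq_eval X x e
    fun hXw => hw ⟨w.2, fun u hu hDu => hno w.1 u w.2 hu hXw hDu⟩

/-! ### Incentive paths -/

namespace CID

variable {V : Type*} {C : CID V} {D X : V}

theorem kind_ne_utility_of_adj {v w : V} (h : C.Adj v w) : C.kind v ≠ NodeKind.utility := fun h' =>
  C.utility_no_children v w h' h

theorem kind_ne_utility_of_hasDirectedPath {v w : V} (h : C.HasDirectedPath v w) (hne : v ≠ w) :
    C.kind v ≠ NodeKind.utility :=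
  let ⟨_, hc, _⟩ := h.cases_head.resolve_left hne
  kind_ne_utility_of_adj hc

variable (C D X) in
/-- A witness of the graphical criterion: the nodes `q 0, …, q n` form an active path from the
parent `q 0` of `D` to the utility node `q n`, where `X` is an ancestor of `q 0` and `D` of `q n`.
The remaining terms of `q` are arbitrary. -/
structure IncentivePath where
  /-- The length of the path. -/
  n : ℕ
  /-- The nodes of the path. -/
  q : ℕ → V
  ne : X ≠ D
  kind_decision : C.kind D = NodeKind.decision
  adj_decision : C.Adj (q 0) D
  kind_last : C.kind (q n) = NodeKind.utility
  path_observation : C.HasDirectedPath X (q 0)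
  path_utility : C.HasDirectedPath D (q n)
  active : C.IsActive (C.family D \ {q 0}) n q
  inj : Set.InjOn q {k | k ≤ n}

namespace IncentivePath

variable (I : C.IncentivePath D X)

/-- The path has a collider at position `i`. There is none at position `0`, as `0 - 1 = 0`. -/
def IsCollider (i : ℕ) : Prop :=
  C.Adj (I.q (i - 1)) (I.q i) ∧ C.Adj (I.q (i + 1)) (I.q i)

theorem not_isCollider_zero : ¬ I.IsCollider 0 := fun h => DAG.Adj.ne h.1 rfl

theorem n_pos : 0 < I.n := by
  refine Nat.pos_of_ne_zero fun h => kind_ne_utility_of_adj I.adj_decision ?_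
  simpa only [h] using I.kind_last

theorem pred_n_lt : I.n - 1 < I.n := Nat.sub_lt I.n_pos one_pos

theorem adj_last : C.Adj (I.q (I.n - 1)) (I.q I.n) := by
  have h := I.active.adj (I.n - 1) I.pred_n_lt
  rw [Nat.sub_add_cancel I.n_pos] at h
  exact h.resolve_right fun h => kind_ne_utility_of_adj h I.kind_last

theorem last_ne_decision : I.q I.n ≠ D := fun h => by
  simpa [h, I.kind_decision] using I.kind_last

theorem adj_pred {i : ℕ} (h0 : 0 < i) (hi : i ≤ I.n) :
    C.Adj (I.q (i - 1)) (I.q i) ∨ C.Adj (I.q i) (I.q (i - 1)) := by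
  obtain ⟨i, rfl⟩ := Nat.exists_eq_add_of_lt h0
  exact I.active.adj _ (by omega)

theorem openAt {i : ℕ} (h0 : 0 < i) (hi : i < I.n) :
    C.OpenAt (C.family D \ {I.q 0}) (I.q (i - 1)) (I.q i) (I.q (i + 1)) := by
  obtain ⟨i, rfl⟩ := Nat.exists_eq_add_of_lt h0
  exact I.active.isOpen _ (by omega)

theorem not_mem_family {i : ℕ} (h0 : 0 < i) (hi : i < I.n) (hc : ¬ I.IsCollider i) :
    I.q i ∉ C.family D := by
  have hne : I.q i ≠ I.q 0 := fun h => h0.ne' (I.inj hi.le (Nat.zero_le _) h)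
  have hout : C.Adj (I.q i) (I.q (i - 1)) ∨ C.Adj (I.q i) (I.q (i + 1)) := by
    rcases I.adj_pred h0 hi.le with hin | hout
    · exact Or.inr ((I.active.adj i hi).resolve_right fun hin' => hc ⟨hin, hin'⟩)
    · exact Or.inl hout
  exact fun hF => (I.openAt h0 hi).1 hout ⟨hF, hne⟩

theorem not_isCollider_pred {i : ℕ} (h : C.Adj (I.q (i - 1)) (I.q i)) :
    ¬ I.IsCollider (i - 1) := by
  rintro ⟨-, hc⟩
  rcases i with _ | i
  · exact DAG.Adj.ne h rfl
  · exact DAG.Adj.asymm h hc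

theorem not_isCollider_succ {i : ℕ} (h : C.Adj (I.q (i + 1)) (I.q i)) :
    ¬ I.IsCollider (i + 1) := fun hc => DAG.Adj.asymm h hc.1

theorem succ_lt_of_adj {i : ℕ} (hi : i < I.n) (h : C.Adj (I.q (i + 1)) (I.q i)) :
    i + 1 < I.n :=
  lt_of_le_of_ne hi fun he => kind_ne_utility_of_adj h (he ▸ I.kind_last)

theorem q_ne_decision {i : ℕ} (hi : i < I.n) : I.q i ≠ D := by
  intro hqD
  rcases Nat.eq_zero_or_pos i with rfl | h0
  · exact DAG.Adj.ne I.adj_decision hqD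
  · by_cases hc : I.IsCollider i
    · have hadj := hc.2
      rw [hqD] at hadj
      exact I.not_mem_family i.succ_pos (I.succ_lt_of_adj hi hc.2) (I.not_isCollider_succ hc.2)
        (Or.inr hadj)
    · exact I.not_mem_family h0 hi hc (Or.inl hqD)

theorem IsCollider.hasDirectedPath {I : C.IncentivePath D X} {i : ℕ} (hi : i < I.n)
    (hc : I.IsCollider i) : C.HasDirectedPath (I.q i) D := by
  have h0 : 0 < i := Nat.pos_of_ne_zero fun h => I.not_isCollider_zero (h ▸ hc)
  obtain ⟨z, ⟨rfl | hz, -⟩, hp⟩ := (I.openAt h0 hi).2 hc.1 hc.2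
  exacts [hp, hp.tail hz]

theorem kind_q_ne_utility {i : ℕ} (hi : i < I.n) : C.kind (I.q i) ≠ NodeKind.utility := by
  by_cases hc : I.IsCollider i
  · exact kind_ne_utility_of_hasDirectedPath (hc.hasDirectedPath hi) (I.q_ne_decision hi)
  · rcases I.active.adj i hi with hout | hin
    · exact kind_ne_utility_of_adj hout
    · rcases Nat.eq_zero_or_pos i with rfl | h0
      · exact kind_ne_utility_of_adj I.adj_decision
      · exact kind_ne_utility_of_adj
          ((I.adj_pred h0 hi.le).resolve_left fun hin' => hc ⟨hin', hin⟩)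

theorem position_induction [Finite V] {motive : ℕ → Prop}
    (step : ∀ i < I.n, (∀ j < I.n, C.Adj (I.q j) (I.q i) → motive j) → motive i) {i : ℕ}
    (hi : i < I.n) : motive i := by
  generalize hv : I.q i = v
  induction v using C.wellFounded_adj.induction generalizing i with
  | _ v ih =>
    subst hv
    exact step i hi fun j hj hji => ih _ hji hj rfl

end IncentivePath

end CID

/-! ### The model of an incentive path -/

open Classical in
/-- A parent of `v` that descends from `a`, or `v` itself if there is none. -/
noncomputable def DAG.relay {V : Type*} (G : DAG V) (a v : V) : V :=
  if h : ∃ w, G.Adj w v ∧ G.HasDirectedPath a w then h.choose else v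

theorem DAG.relay_spec {V : Type*} {G : DAG V} {a v : V} (h : G.HasDirectedPath a v)
    (hne : v ≠ a) : G.Adj (G.relay a v) v ∧ G.HasDirectedPath a (G.relay a v) := by
  have hex : ∃ w, G.Adj w v ∧ G.HasDirectedPath a w :=
    let ⟨w, hp, hw⟩ := h.cases_tail.resolve_left hne
    ⟨w, hw, hp⟩
  rw [DAG.relay, dif_pos hex]
  exact hex.choose_spec

theorem mutuallyIndependent_uniformOfFintype {V : Type*} [Fintype V] [DecidableEq V]
    {Exo : V → Type} [∀ v, Fintype (Exo v)] [∀ v, Nonempty (Exo v)] :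
    MutuallyIndependent (PMF.uniformOfFintype (∀ v, Exo v)) := by
  classical
  have marginal : ∀ v a, ((PMF.uniformOfFintype (∀ v, Exo v)).map fun e => e v) a =
      (Fintype.card (Exo v) : ENNReal)⁻¹ := by
    intro v a
    have hcard : (Finset.univ.filter fun e : ∀ v, Exo v => a = e v).card =
        ∏ w ∈ Finset.univ.erase v, Fintype.card (Exo w) := by
      simpa only [eq_comm, Fintype.piFinset_univ, Finset.card_univ] using
        Fintype.card_filter_piFinset_eq_of_mem (fun _ => Finset.univ) v (Finset.mem_univ a)
    have hprod : (∏ w ∈ Finset.univ.erase v, (Fintype.card (Exo w) : ENNReal)) ≠ 0 :=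
      Finset.prod_ne_zero_iff.2 fun w _ => by simp
    rw [PMF.map_apply, tsum_fintype, ← Finset.sum_filter]
    simp only [PMF.uniformOfFintype_apply, Finset.sum_const, nsmul_eq_mul, hcard, Fintype.card_pi,
      Nat.cast_prod]
    rw [← Finset.mul_prod_erase _ _ (Finset.mem_univ v),
      ENNReal.mul_inv (by simp) (by simp), mul_left_comm, ENNReal.mul_inv_cancel hprod
        (ENNReal.prod_ne_top fun w _ => by simp), mul_one]
  intro e
  simp only [marginal, PMF.uniformOfFintype_apply, Fintype.card_pi, Nat.cast_prod]
  exact ENNReal.prod_inv_distrib fun v _ w _ _ => by simp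

theorem exists_embedding_real_lt {α : Type*} [Countable α] {a b : α} (h : a ≠ b) :
    ∃ ι : α ↪ ℝ, ι a < ι b := by
  obtain ⟨ι⟩ := nonempty_embedding_nat α
  let ιR : α ↪ ℝ := ι.trans Nat.castEmbedding
  rcases (ιR.injective.ne h).lt_or_gt with hlt | hgt
  · exact ⟨ιR, hlt⟩
  · exact ⟨ιR.trans (Equiv.neg ℝ).toEmbedding, neg_lt_neg hgt⟩

namespace CID.IncentivePath

/-- The channels on which a node can send a sign to all its descendants: one for each position on
a path of length `n`, which only the colliders use, one for the mask that is sent by `X`, and one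
for the decision. -/
inductive Channel (n : ℕ) where
  | collider (i : Fin n)
  | mask
  | decision
  deriving Fintype

/-- The values of the nodes: the sign of the node as a member of the path, which is `0` if it is
masked, and the signs received or sent on the channels. -/
abbrev Message (n : ℕ) : Type := SignType × (Channel n → SignType)

/-- The values of the utility nodes, which take only the values `0` and `1`. -/
noncomputable def utility (n : ℕ) : Message n ↪ ℝ :=
  (exists_embedding_real_lt (zero_ne_one (α := Message n))).choose

theorem utility_zero_lt_one (n : ℕ) : utility n 0 < utility n 1 :=
  (exists_embedding_real_lt zero_ne_one).choose_spec

variable {V : Type*} {C : CID V} {D X : V} (I : C.IncentivePath D X)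

/-- The node that sends on the channel `k`. -/
def origin : Channel I.n → V
  | .collider i => I.q i
  | .mask => X
  | .decision => D

open Classical in
/-- The message of the parent `w`, or a neutral message if `w` is not a parent. -/
noncomputable def input {n : ℕ} {v : V} (pa : C.parents v → Message n) (w : V) : Message n :=
  if h : C.Adj w v then pa ⟨w, h⟩ else 1

open Classical in
/-- The sign of `v` on the channel `k`: its `own` sign if `v` is the origin, and otherwise the sign
of a parent through which the channel passes. -/
noncomputable def forward (v : V) (pa : C.parents v → Message I.n) (k : Channel I.n)
    (own : SignType) : SignType :=
  if v = I.origin k then own else (input pa (C.relay (I.origin k) v)).2 k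

open Classical in
/-- The sign of `v` as a member of the path: the product of the signs of those neighbours on the
path that are parents, or the exogenous sign if there are none. The sign of `q 0` is multiplied by
the mask `m`, as received from `X`. The outer product has at most one factor. -/
noncomputable def pathSign (m : SignType) (v : V) (pa : C.parents v → Message I.n)
    (ε : SignTypeˣ) : SignType :=
  ∏ i ∈ Finset.range I.n with I.q i = v,
    (if i = 0 then I.forward v pa .mask m else 1) *
      if C.Adj (I.q (i - 1)) v ∨ C.Adj (I.q (i + 1)) v then
        (input pa (I.q (i - 1))).1 * (input pa (I.q (i + 1))).1
      else ε

open Classical in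
/-- The sign that the node `v` sends on the channel `k` if it is the origin. -/
noncomputable def ownSign (m : SignType) (v : V) (pa : C.parents v → Message I.n)
    (ε : SignTypeˣ) : Channel I.n → SignType
  | .collider i => if I.IsCollider i then I.pathSign m v pa ε else 1
  | .mask => m
  | .decision => 1

open Classical in
/-- The structural functions. The utility node `q n` compares the decision with the sign of the
last node before it. -/
noncomputable def structural (m : SignType) (v : V) (pa : C.parents v → Message I.n)
    (ε : SignTypeˣ) : Message I.n :=
  if C.kind v = NodeKind.utility then
    if v = I.q I.n ∧ (input pa (I.q (I.n - 1))).1 = (input pa (C.relay D v)).2 .decision then 1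
    else 0
  else (I.pathSign m v pa ε, fun k => I.forward v pa k (I.ownSign m v pa ε k))

/-- The model in which the node `X` sends the mask `m`. -/
@[reducible] noncomputable def model [Fintype V] [DecidableEq V] (m : SignType) : SCIM C where
  Dom _ := Message I.n
  util _ _ := utility I.n
  Exo _ := SignTypeˣ
  f v _ := I.structural m v
  P := PMF.uniformOfFintype (V → SignTypeˣ)
  indep := mutuallyIndependent_uniformOfFintype

/-- The values `x` satisfy the structural equations of all nodes but the decision. -/
def IsSolution (m : SignType) (e : V → SignTypeˣ) (x : V → Message I.n) : Prop :=
  ∀ v, v ≠ D → x v = I.structural m v (fun w => x w.1) (e v)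

variable {I} {m : SignType} {e e' : V → SignTypeˣ} {x y : V → Message I.n}

theorem input_of_adj {v w : V} (h : C.Adj w v) : input (fun w : C.parents v => x w.1) w = x w :=
  dif_pos h

theorem input_of_not_adj {n : ℕ} {v w : V} (h : ¬ C.Adj w v) (pa : C.parents v → Message n) :
    input pa w = 1 :=
  dif_neg h

theorem forward_of_ne {k : Channel I.n} {v : V} (h : v ≠ I.origin k)
    (pa : C.parents v → Message I.n) (own : SignType) :
    I.forward v pa k own = (input pa (C.relay (I.origin k) v)).2 k :=
  if_neg h

namespace IsSolution

theorem eq_of_ne (hx : I.IsSolution m e x) {v : V} (hv : v ≠ D) (hu : C.kind v ≠ .utility) :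
    x v = (I.pathSign m v (fun w => x w.1) (e v), fun k =>
      I.forward v (fun w => x w.1) k (I.ownSign m v (fun w => x w.1) (e v) k)) := by
  rw [hx v hv, structural, if_neg hu]

theorem fst_eq (hx : I.IsSolution m e x) {v : V} (hv : v ≠ D) (hu : C.kind v ≠ .utility) :
    (x v).1 = I.pathSign m v (fun w => x w.1) (e v) := by
  rw [hx.eq_of_ne hv hu]

theorem snd_eq (hx : I.IsSolution m e x) {v : V} (hv : v ≠ D) (hu : C.kind v ≠ .utility)
    (k : Channel I.n) :
    (x v).2 k = I.forward v (fun w => x w.1) k (I.ownSign m v (fun w => x w.1) (e v) k) := by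
  rw [hx.eq_of_ne hv hu]

theorem snd_origin (hx : I.IsSolution m e x) {k : Channel I.n} (hD : I.origin k ≠ D)
    (hu : C.kind (I.origin k) ≠ .utility) :
    (x (I.origin k)).2 k = I.ownSign m (I.origin k) (fun w => x w.1) (e (I.origin k)) k := by
  rw [hx.snd_eq hD hu, forward, if_pos rfl]

variable [Finite V]

theorem snd_eq_origin (hx : I.IsSolution m e x) {k : Channel I.n} {v : V}
    (hk : C.HasDirectedPath (I.origin k) v)
    (hD : I.origin k = D ∨ C.HasDirectedPath v D ∧ v ≠ D) (hu : C.kind v ≠ .utility) :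
    (x v).2 k = (x (I.origin k)).2 k := by
  induction v using C.wellFounded_adj.induction with
  | _ v ih =>
    by_cases hv : v = I.origin k
    · rw [hv]
    · have hvD : v ≠ D := hD.elim (fun h => h ▸ hv) And.right
      obtain ⟨hadj, hpath⟩ := DAG.relay_spec hk hv
      rw [hx.snd_eq hvD hu, forward_of_ne hv, input_of_adj hadj]
      refine ih _ hadj hpath (hD.imp_right fun h => ⟨.head hadj h.1, fun hrD => ?_⟩)
        (kind_ne_utility_of_adj hadj)
      rw [hrD] at hadj
      exact h.1.not_adj hadj

theorem forward_mask_eq (hx : I.IsSolution m e x) :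
    I.forward (I.q 0) (fun w => x w.1) .mask m = m := by
  have hX : (x X).2 .mask = m := hx.snd_origin (k := .mask) I.ne
    (kind_ne_utility_of_hasDirectedPath (I.path_observation.tail I.adj_decision) I.ne)
  have hu := kind_ne_utility_of_adj I.adj_decision
  have hq : I.q 0 ≠ D := I.q_ne_decision I.n_pos
  calc I.forward (I.q 0) (fun w => x w.1) .mask m = (x (I.q 0)).2 .mask :=
        (hx.snd_eq hq hu .mask).symm
    _ = (x X).2 .mask :=
        hx.snd_eq_origin I.path_observation (Or.inr ⟨.single I.adj_decision, hq⟩) hu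
    _ = m := hX

open Classical in
theorem sign_eq (hx : I.IsSolution m e x) {i : ℕ} (hi : i < I.n) :
    (x (I.q i)).1 = (if i = 0 then m else 1) *
      if C.Adj (I.q (i - 1)) (I.q i) ∨ C.Adj (I.q (i + 1)) (I.q i) then
        (input (fun w : C.parents (I.q i) => x w.1) (I.q (i - 1))).1 *
          (input (fun w : C.parents (I.q i) => x w.1) (I.q (i + 1))).1
      else e (I.q i) := by
  have hfilter : Finset.filter (fun j => I.q j = I.q i) (Finset.range I.n) = {i} := by
    ext j
    simp only [Finset.mem_filter, Finset.mem_range, Finset.mem_singleton]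
    exact ⟨fun h => I.inj h.1.le hi.le h.2, by rintro rfl; exact ⟨hi, rfl⟩⟩
  rw [hx.fst_eq (I.q_ne_decision hi) (I.kind_q_ne_utility hi), pathSign, hfilter,
    Finset.prod_singleton]
  rcases Nat.eq_zero_or_pos i with rfl | h0
  · simp only [hx.forward_mask_eq]
  · simp only [h0.ne', if_false]

theorem sign_collider (hx : I.IsSolution m e x) {i : ℕ} (hi : i < I.n) (hc : I.IsCollider i) :
    (x (I.q i)).1 = (x (I.q (i - 1))).1 * (x (I.q (i + 1))).1 := by
  have h0 : i ≠ 0 := fun h => I.not_isCollider_zero (h ▸ hc)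
  rw [hx.sign_eq hi, input_of_adj hc.1, input_of_adj hc.2, if_pos (Or.inl hc.1), if_neg h0,
    one_mul]

theorem sign_left (hx : I.IsSolution m e x) {i : ℕ} (hi : i < I.n)
    (hl : C.Adj (I.q (i - 1)) (I.q i)) (hr : ¬ C.Adj (I.q (i + 1)) (I.q i)) :
    (x (I.q i)).1 = (x (I.q (i - 1))).1 := by
  have h0 : i ≠ 0 := by
    rintro rfl
    exact DAG.Adj.ne hl rfl
  rw [hx.sign_eq hi, input_of_adj hl, input_of_not_adj hr, if_pos (Or.inl hl), if_neg h0, one_mul,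
    Prod.fst_one, mul_one]

theorem sign_right (hx : I.IsSolution m e x) {i : ℕ} (hi : i < I.n)
    (hl : ¬ C.Adj (I.q (i - 1)) (I.q i)) (hr : C.Adj (I.q (i + 1)) (I.q i)) :
    (x (I.q i)).1 = (if i = 0 then m else 1) * (x (I.q (i + 1))).1 := by
  rw [hx.sign_eq hi, input_of_not_adj hl, input_of_adj hr, if_pos (Or.inr hr), Prod.fst_one,
    one_mul]

theorem sign_source (hx : I.IsSolution m e x) {i : ℕ} (hi : i < I.n)
    (hl : ¬ C.Adj (I.q (i - 1)) (I.q i)) (hr : ¬ C.Adj (I.q (i + 1)) (I.q i)) :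
    (x (I.q i)).1 = (if i = 0 then m else 1) * (e (I.q i) : SignType) := by
  rw [hx.sign_eq hi, if_neg (not_or_intro hl hr)]

/-! ### Flipping the exogenous signs -/

section Flip

variable (he : ∀ v, v ≠ D → e v = -e' v)

include he

theorem sign_eq_neg (hx : I.IsSolution m e x) (hy : I.IsSolution m e' y) {i : ℕ} (hi : i < I.n)
    (hc : ¬ I.IsCollider i) : (x (I.q i)).1 = -(y (I.q i)).1 := by
  revert hc
  refine I.position_induction (motive := fun i => ¬ I.IsCollider i → (x (I.q i)).1 =
    -(y (I.q i)).1) (fun i hi ih hc => ?_) hi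
  by_cases hl : C.Adj (I.q (i - 1)) (I.q i)
  · have hr : ¬ C.Adj (I.q (i + 1)) (I.q i) := fun hr => hc ⟨hl, hr⟩
    rw [hx.sign_left hi hl hr, hy.sign_left hi hl hr]
    exact ih _ (by omega) hl (I.not_isCollider_pred hl)
  · by_cases hr : C.Adj (I.q (i + 1)) (I.q i)
    · rw [hx.sign_right hi hl hr, hy.sign_right hi hl hr,
        ih _ (I.succ_lt_of_adj hi hr) hr (I.not_isCollider_succ hr), mul_neg]
    · rw [hx.sign_source hi hl hr, hy.sign_source hi hl hr, he _ (I.q_ne_decision hi),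
        Units.val_neg, mul_neg]

theorem sign_collider_eq (hx : I.IsSolution m e x) (hy : I.IsSolution m e' y) {i : ℕ}
    (hi : i < I.n) (hc : I.IsCollider i) : (x (I.q i)).1 = (y (I.q i)).1 := by
  rw [hx.sign_collider hi hc, hy.sign_collider hi hc,
    hx.sign_eq_neg he hy (by omega) (I.not_isCollider_pred hc.1),
    hx.sign_eq_neg he hy (I.succ_lt_of_adj hi hc.2) (I.not_isCollider_succ hc.2), neg_mul_neg]

theorem ownSign_eq (hx : I.IsSolution m e x) (hy : I.IsSolution m e' y) {k : Channel I.n}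
    (hD : I.origin k ≠ D) (hu : C.kind (I.origin k) ≠ .utility) :
    I.ownSign m (I.origin k) (fun w => x w.1) (e (I.origin k)) k =
      I.ownSign m (I.origin k) (fun w => y w.1) (e' (I.origin k)) k := by
  rcases k with i | _ | _
  · by_cases hc : I.IsCollider i
    · simp only [ownSign, if_pos hc]
      rw [← hx.fst_eq hD hu, ← hy.fst_eq hD hu]
      exact hx.sign_collider_eq he hy i.2 hc
    · simp only [ownSign, if_neg hc]
  · rfl
  · rfl

theorem snd_eq_of_flip (hx : I.IsSolution m e x) (hy : I.IsSolution m e' y) (k : Channel I.n)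
    {v : V} (hv : C.HasDirectedPath v D) (hvD : v ≠ D) : (x v).2 k = (y v).2 k := by
  induction v using C.wellFounded_adj.induction with
  | _ v ih =>
    have hu := kind_ne_utility_of_hasDirectedPath hv hvD
    by_cases hk : v = I.origin k
    · subst hk
      rw [hx.snd_origin hvD hu, hy.snd_origin hvD hu, hx.ownSign_eq he hy hvD hu]
    · rw [hx.snd_eq hvD hu, hy.snd_eq hvD hu, forward_of_ne hk, forward_of_ne hk]
      by_cases hw : C.Adj (C.relay (I.origin k) v) v
      · rw [input_of_adj hw, input_of_adj hw]
        refine ih _ hw (.head hw hv) fun h => ?_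
        rw [h] at hw
        exact hv.not_adj hw
      · rw [input_of_not_adj hw, input_of_not_adj hw]

theorem parents_eq_of_masked (hx : I.IsSolution 0 e x) (hy : I.IsSolution 0 e' y) {v : V}
    (hv : C.Adj v D) : x v = y v := by
  classical
  refine Prod.ext ?_ (funext fun k => hx.snd_eq_of_flip he hy k (.single hv) (DAG.Adj.ne hv))
  by_cases hp : ∃ i < I.n, I.q i = v
  · obtain ⟨i, hi, rfl⟩ := hp
    rcases Nat.eq_zero_or_pos i with rfl | h0
    · rw [hx.sign_eq hi, hy.sign_eq hi, if_pos rfl, zero_mul, zero_mul]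
    · refine hx.sign_collider_eq he hy hi (not_not.1 fun hc => ?_)
      exact I.not_mem_family h0 hi hc (Or.inr hv)
  · have hq : ∀ i ∈ Finset.range I.n, ¬ I.q i = v := fun i hi hiv =>
      hp ⟨i, Finset.mem_range.1 hi, hiv⟩
    have hu := kind_ne_utility_of_adj hv
    rw [hx.fst_eq (DAG.Adj.ne hv) hu, hy.fst_eq (DAG.Adj.ne hv) hu, pathSign, pathSign,
      Finset.filter_false_of_mem hq, Finset.prod_empty, Finset.prod_empty]

end Flip

/-! ### Decoding the last sign of the path -/

theorem sign_ne_zero (hx : I.IsSolution 1 e x) {i : ℕ} (hi : i < I.n) : (x (I.q i)).1 ≠ 0 := by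
  refine I.position_induction (motive := fun i => (x (I.q i)).1 ≠ 0) (fun i hi ih => ?_) hi
  by_cases hl : C.Adj (I.q (i - 1)) (I.q i)
  · by_cases hr : C.Adj (I.q (i + 1)) (I.q i)
    · rw [hx.sign_collider hi ⟨hl, hr⟩]
      exact mul_ne_zero (ih _ (by omega) hl) (ih _ (I.succ_lt_of_adj hi hr) hr)
    · rw [hx.sign_left hi hl hr]
      exact ih _ (by omega) hl
  · by_cases hr : C.Adj (I.q (i + 1)) (I.q i)
    · rw [hx.sign_right hi hl hr, ite_self, one_mul]
      exact ih _ (I.succ_lt_of_adj hi hr) hr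
    · rw [hx.sign_source hi hl hr, ite_self, one_mul]
      exact (e (I.q i)).ne_zero

end IsSolution

variable (I) in
open Classical in
/-- The sign of the tail of the edge between `q i` and `q (i + 1)`. -/
noncomputable def edgeSign (x : V → Message I.n) (i : ℕ) : SignType :=
  if C.Adj (I.q i) (I.q (i + 1)) then (x (I.q i)).1 else (x (I.q (i + 1))).1

variable (I) in
open Classical in
/-- The factor by which the sign changes at position `i` of the path. -/
noncomputable def colliderSign (x : V → Message I.n) (i : ℕ) : SignType :=
  if I.IsCollider i then (x (I.q i)).1 else 1

variable (I) in
open Classical in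
/-- The sign of the last node before `q n`, computed from the parents of `D`. -/
noncomputable def decode (pa : C.parents D → Message I.n) : SignType :=
  (input pa (I.q 0)).1 * ∏ i : Fin I.n,
    if I.IsCollider i then (input pa (C.relay (I.q i) D)).2 (.collider i) else 1

namespace IsSolution

variable [Finite V]

theorem edgeSign_zero (hx : I.IsSolution 1 e x) : I.edgeSign x 0 = (x (I.q 0)).1 := by
  rw [edgeSign]
  split_ifs with h
  · rfl
  · have hr := (I.active.adj 0 I.n_pos).resolve_left h
    rw [hx.sign_right I.n_pos (fun h => DAG.Adj.ne h rfl) hr, ite_self, one_mul]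

theorem edgeSign_succ (hx : I.IsSolution 1 e x) {i : ℕ} (hi : i + 1 < I.n) :
    I.edgeSign x (i + 1) = I.edgeSign x i * I.colliderSign x (i + 1) := by
  rw [edgeSign, edgeSign, colliderSign]
  rcases I.active.adj i (by omega) with hl | hl
  · rcases I.active.adj (i + 1) hi with hr | hr
    · have hc : ¬ I.IsCollider (i + 1) := fun hc => DAG.Adj.asymm hr hc.2
      rw [if_pos hl, if_pos hr, if_neg hc, mul_one]
      exact hx.sign_left hi hl (DAG.Adj.asymm hr)
    · have hc : I.IsCollider (i + 1) := ⟨hl, hr⟩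
      have square_eq_one : ∀ a : SignType, a ≠ 0 → a * a = 1 := by decide
      rw [if_pos hl, if_neg (DAG.Adj.asymm hr), if_pos hc, hx.sign_collider hi hc,
        Nat.add_sub_cancel, ← mul_assoc, square_eq_one _ (hx.sign_ne_zero (by omega)), one_mul]
  · rw [if_neg (DAG.Adj.asymm hl), if_neg (I.not_isCollider_succ hl), mul_one]
    split_ifs with hr
    · rfl
    · have hr' := (I.active.adj (i + 1) hi).resolve_left hr
      rw [hx.sign_right hi (DAG.Adj.asymm hl) hr', ite_self, one_mul]

theorem edgeSign_eq_prod (hx : I.IsSolution 1 e x) {i : ℕ} (hi : i < I.n) :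
    I.edgeSign x i = (x (I.q 0)).1 * ∏ j ∈ Finset.range (i + 1), I.colliderSign x j := by
  induction i with
  | zero =>
    rw [hx.edgeSign_zero, Finset.prod_range_one, colliderSign, if_neg I.not_isCollider_zero,
      mul_one]
  | succ i ih => rw [Finset.prod_range_succ, ← mul_assoc, ← ih (by omega), hx.edgeSign_succ hi]

theorem decode_eq (hx : I.IsSolution 1 e x) :
    I.decode (fun w => x w.1) = (x (I.q (I.n - 1))).1 := by
  have hlast : I.edgeSign x (I.n - 1) = (x (I.q (I.n - 1))).1 := by
    rw [edgeSign, Nat.sub_add_cancel I.n_pos, if_pos I.adj_last]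
  rw [← hlast, hx.edgeSign_eq_prod I.pred_n_lt, Nat.sub_add_cancel I.n_pos, decode,
    input_of_adj I.adj_decision, ← Fin.prod_univ_eq_prod_range]
  refine congrArg _ (Finset.prod_congr rfl fun i _ => ?_)
  rw [colliderSign]
  split_ifs with hc
  · have hD := I.q_ne_decision i.2
    have hu := I.kind_q_ne_utility i.2
    obtain ⟨hadj, hpath⟩ := DAG.relay_spec (hc.hasDirectedPath i.2) hD.symm
    calc (input (fun w : C.parents D => x w.1) (C.relay (I.q i) D)).2 (.collider i)
        = (x (C.relay (I.q i) D)).2 (.collider i) := by rw [input_of_adj hadj]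
      _ = (x (I.q i)).2 (.collider i) := hx.snd_eq_origin hpath
          (Or.inr ⟨.single hadj, DAG.Adj.ne hadj⟩) (kind_ne_utility_of_adj hadj)
      _ = (x (I.q i)).1 := by
          rw [hx.fst_eq hD hu]
          exact (hx.snd_origin (k := .collider i) hD hu).trans (if_pos hc)
  · rfl

open Classical in
theorem utility_eq (hx : I.IsSolution m e x) {u : V} (hu : C.kind u = .utility) :
    x u = if u = I.q I.n ∧ (x (I.q (I.n - 1))).1 = (x D).2 .decision then 1 else 0 := by
  by_cases hn : u = I.q I.n
  · subst hn
    obtain ⟨hadj, hpath⟩ := DAG.relay_spec I.path_utility I.last_ne_decision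
    have hdecision : (x (C.relay D (I.q I.n))).2 .decision = (x D).2 .decision :=
      hx.snd_eq_origin hpath (Or.inl rfl) (kind_ne_utility_of_adj hadj)
    rw [hx _ I.last_ne_decision, structural, if_pos hu, input_of_adj I.adj_last,
      input_of_adj hadj, hdecision]
  · have huD : u ≠ D := by
      rintro rfl
      simp [I.kind_decision] at hu
    rw [hx u huD, structural, if_pos hu, if_neg fun h => hn h.1, if_neg fun h => hn h.1]

end IsSolution

/-! ### Optimal policies respond to the mask -/

theorem structural_of_ne {v : V} (hv : v ≠ X) (m m' : SignType) :
    I.structural m v = I.structural m' v := by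
  have hmask : ∀ pa, I.forward v pa .mask m = I.forward v pa .mask m' := fun pa => by
    rw [forward_of_ne hv, forward_of_ne hv]
  have hsign : I.pathSign m v = I.pathSign m' v := by
    funext pa ε
    simp only [pathSign, hmask]
  have hforward : ∀ pa ε k, I.forward v pa k (I.ownSign m v pa ε k) =
      I.forward v pa k (I.ownSign m' v pa ε k) := by
    rintro pa ε (i | _ | _)
    · simp only [ownSign, hsign]
    · exact hmask pa
    · rfl
  funext pa ε
  simp only [structural, hsign, hforward]

section Model

variable [Fintype V] [DecidableEq V] (hD : C.IsSingleDecision D)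

theorem isSolution_value (m : SignType) (π : (I.model m).Policy D) (e : V → SignTypeˣ) :
    I.IsSolution m e ((I.model m).value hD π e) := fun _ hv => (I.model m).value_of_ne hD π e hv

variable (I) in
/-- The decision under the policy `π` agrees with the sign of the last node before `q n`. -/
def Matches (π : (I.model 1).Policy D) (e : V → SignTypeˣ) : Prop :=
  ((I.model 1).value hD π e (I.q (I.n - 1))).1 = ((I.model 1).value hD π e D).2 .decision

open Classical in
theorem totalUtility_eq_sum (π : (I.model 1).Policy D) (e : V → SignTypeˣ) :
    (I.model 1).totalUtility hD π e = ∑ u : {u : V // C.kind u = NodeKind.utility},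
      utility I.n (if u.1 = I.q I.n ∧ I.Matches hD π e then 1 else 0) :=
  Finset.sum_congr rfl fun u _ => congrArg _
    (((isSolution_value hD 1 π e).utility_eq u.2).trans (by unfold Matches; congr))

variable (I) in
/-- The policy that decides on the sign of the last node before `q n`. -/
noncomputable def decodingPolicy : (I.model 1).Policy D := fun pa _ => (1, fun _ => I.decode pa)

theorem matches_decodingPolicy (e : V → SignTypeˣ) : I.Matches hD I.decodingPolicy e := by
  rw [Matches, (I.model 1).value_decision hD]
  exact (isSolution_value hD 1 _ e).decode_eq.symm

theorem matches_of_isOptimal {π : (I.model 1).Policy D} (hπ : (I.model 1).IsOptimal hD π)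
    (e : V → SignTypeˣ) : I.Matches hD π e := by
  classical
  have hρ : ∀ e, I.Matches hD I.decodingPolicy e := matches_decodingPolicy hD
  have hterm : ∀ e, ∀ u ∈ (Finset.univ : Finset {u : V // C.kind u = NodeKind.utility}),
      utility I.n (if u.1 = I.q I.n ∧ I.Matches hD π e then 1 else 0) ≤
        utility I.n (if u.1 = I.q I.n ∧ I.Matches hD I.decodingPolicy e then 1 else 0) := by
    intro e u _
    simp only [hρ, and_true]
    split_ifs with h hu hu
    exacts [le_rfl, absurd h.1 hu, (utility_zero_lt_one I.n).le, le_rfl]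
  have hle : ∀ e, (I.model 1).totalUtility hD π e ≤
      (I.model 1).totalUtility hD I.decodingPolicy e := fun e => by
    rw [totalUtility_eq_sum, totalUtility_eq_sum]
    exact Finset.sum_le_sum (hterm e)
  have heq := hπ.totalUtility_eq_of_le hle
    ((PMF.mem_support_iff _ _).1 (PMF.mem_support_uniformOfFintype e))
  rw [totalUtility_eq_sum, totalUtility_eq_sum, Finset.sum_eq_sum_iff_of_le (hterm e)] at heq
  have hlast := (utility I.n).injective (heq ⟨I.q I.n, I.kind_last⟩ (Finset.mem_univ _))
  by_contra hno
  rw [if_neg fun h => hno h.2, if_pos ⟨rfl, hρ e⟩] at hlast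
  exact zero_ne_one hlast

theorem potentialResponse_eq_value (π : (I.model 1).Policy D) (e : V → SignTypeˣ) (v : V) :
    ((I.model 1).withPolicy hD π).potentialResponse X ((I.model 0).value hD π e X) e v =
      (I.model 0).value hD π e v := by
  symm
  refine SCM.eq_eval (((I.model 1).withPolicy hD π).intervene X ((I.model 0).value hD π e X))
    (x := (I.model 0).value hD π e) (fun v => ?_) v
  by_cases hv : v = X
  · subst hv
    exact (congrFun (congrFun (SCM.intervene_f_self ((I.model 1).withPolicy hD π) _ _) _) _).symm
  · rw [SCM.intervene_f_of_ne ((I.model 1).withPolicy hD π) _ _ _ hv]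
    by_cases hvD : v = D
    · subst hvD
      rw [SCIM.withPolicy_f_decision]
      exact (I.model 0).value_decision hD π e
    · rw [SCIM.withPolicy_f_of_ne _ hD π v (hD.kind_ne_decision hvD),
        (I.model 0).value_of_ne hD π e hvD]
      exact congrFun (congrFun (structural_of_ne hv 0 1) _) _

theorem value_decision_eq_of_masked (π : (I.model 0).Policy D)
    (he : ∀ v, v ≠ D → e v = -e' v) (heD : e D = e' D) :
    (I.model 0).value hD π e D = (I.model 0).value hD π e' D := by
  rw [(I.model 0).value_decision hD π, (I.model 0).value_decision hD π, heD]
  congr 1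
  funext w
  exact (isSolution_value hD 0 π e).parents_eq_of_masked he (isSolution_value hD 0 π e') w.2

variable (I) in
/-- Otherwise the decision would be the same with the mask `0`, and hence would not react when all
the other exogenous signs are flipped, but the sign that it has to match does. -/
theorem hasResponseIncentive : (I.model 1).HasResponseIncentive hD X := by
  intro π hπ
  by_contra! hno
  let e : V → SignTypeˣ := fun _ => 1
  let e' : V → SignTypeˣ := fun v => if v = D then 1 else -1
  have he : ∀ v, v ≠ D → e v = -e' v := fun v hv => by simp [e, e', hv]
  have masked_eq : ∀ e, (I.model 0).value hD π e D = (I.model 1).value hD π e D := fun e => by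
    rw [← potentialResponse_eq_value hD π e D]
    exact hno _ e
  have decision_eq : (I.model 1).value hD π e D = (I.model 1).value hD π e' D := by
    rw [← masked_eq, ← masked_eq]
    exact value_decision_eq_of_masked hD π he (by simp [e, e'])
  have hx := isSolution_value (I := I) hD 1 π e
  have hy := isSolution_value (I := I) hD 1 π e'
  have sign_neg := hx.sign_eq_neg he hy I.pred_n_lt (I.not_isCollider_pred I.adj_last)
  have sign_eq : ((I.model 1).value hD π e (I.q (I.n - 1))).1 =
      ((I.model 1).value hD π e' (I.q (I.n - 1))).1 :=
    (matches_of_isOptimal hD hπ e).trans <|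
      (congrArg (fun d => d.2 .decision) decision_eq).trans (matches_of_isOptimal hD hπ e').symm
  refine hy.sign_ne_zero I.pred_n_lt (SignType.neg_eq_self_iff.1 ?_)
  exact sign_neg.symm.trans sign_eq

end Model

end CID.IncentivePath

theorem mainTheorem1 {V : Type*} [Fintype V] [DecidableEq V] (C : CID V) (D : V)
    (hD : C.IsSingleDecision D) (X : V) (hX : X ≠ D) :
    C.CompatibleWithResponseIncentive hD X ↔
      ∃ W U : V, W ∈ C.parents D ∧ C.kind U = NodeKind.utility ∧
        C.HasDirectedPath X W ∧
        C.HasDirectedPath D U ∧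
        C.DConn {W} {U} (C.family D \ {W}) := by
  refine ⟨fun h => h.exists_dConn hX, ?_⟩
  rintro ⟨W, U, hW, hU, hXW, hDU, hc⟩
  obtain ⟨n, q, rfl, rfl, hact, hinj⟩ := DAG.dConn_singleton_iff.1 hc
  let I : C.IncentivePath D X := ⟨n, q, hX, (hD D).2 rfl, hW, hU, hXW, hDU, hact, hinj⟩
  exact ⟨I.model 1, I.hasResponseIncentive hD⟩
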